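/- **Theorem.** For a prime power $q$, let the *rank* of a vector $v\in\mathbb{F}_{q^4}^4$ be the dimension over $\mathbb{F}_q$ of the $\mathbb{F}_q$-span of its entries, and let $\mathscr{L}_2(4,4;q)$ be the set of all $\mathbb{F}_{q^4}$-linear subspaces $\langle v_1,\dots,v_\ell\rangle_{\mathbb{F}_{q^4}}$ of $\mathbb{F}_{q^4}^4$ with $\ell\ge 1$ and $v_1,\dots,v_\ell$ of rank at most $2$, ordered by inclusion. This is a finite lattice, graded by the $\mathbb{F}_{q^4}$-dimension. Let $\mu$ be its Möbius function, let $$w_j(2,4,4;q)=\sum_{\substack{s\in\mathscr{L}_2(4,4;q)\\ \dim s=j}}\mu(0,s)$$ be its $j$-th Whitney number of the first kind, and let $$\chi(\mathscr{L}_2(4,4;q);\lambda)=\sum_{s\in\mathscr{L}_2(4,4;q)}\mu(0,s)\,\lambda^{4-\dim s}$$ be its characteristic polynomial. Suppose that $w_2(2,4,4;q)$ is a polynomial in $q$, i.e., that there is $P\in\mathbb{Q}[x]$ with $w_2(2,4,4;q)=P(q)$ for every prime power $q$. Then, for every prime power $q$, $$\begin{aligned} w_0(2,4,4;q) &= 1,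 \\ w_1(2,4,4;q) &= -\left(q^8 + q^7 + 2q^6 - q^3 + 1\right), \\ w_2(2,4,4;q) &= \tfrac{1}{2} \left( q^{16} + 3q^{14} + q^{13} + 3q^{12} + q^{11} + q^{10} - q^9 + q^7 + 4q^6 - 2q^3\right), \\ w_3(2,4,4;q) &= -\tfrac{1}{2}\left( q^{20} + 3q^{18} + q^{17} + 2q^{16} - q^{15} + 3q^{12} + 2q^{11} + q^{10} - q^9 - 2q^8 - q^7\right), \\ w_4(2,4,4;q) &= \tfrac{1}{2}\left(q^{20} + 3q^{18} + q^{17} + q^{16} - q^{15} - 3q^{14} - q^{13} + q^{11}\right). \end{aligned}$$ In particular, $$\chi(\mathscr{L}_2(4,4;q);\lambda)=(\lambda-1)(\lambda-q^4)\Bigl(\lambda^2-(q^8 + q^7 + 2q^6 - q^4 - q^3)\lambda+\tfrac{1}{2}\left(q^{16} + 3q^{14} + q^{13} + q^{12} - q^{11} - 3q^{10} - q^9 + q^7\right)\Bigr).$$ -/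

import Mathlib

universe u v

section LatticeInvariants

variable (L : Type*) [Lattice L] [BoundedOrder L] [Fintype L] [DecidableEq L]
  [LocallyFiniteOrder L] [GradeMinOrder ℕ L]

/-- The `j`-th Whitney number of the first kind of a finite graded lattice `L`: the sum of
`μ(0, s)` over the elements `s` of rank `j`. The rank function is `grade ℕ`: it is `0` at the
minimum and goes up by exactly one along every covering relation. -/
def whitneyFirst (j : ℕ) : ℤ :=
  ∑ s : L with grade ℕ s = j, IncidenceAlgebra.mu ℤ (⊥ : L) s

/-- The characteristic polynomial `∑ s, μ(0, s) λ ^ (rk L - ρ(s))` of a finite graded lattice.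
The exponent is never truncated, since `grade ℕ` is monotone. -/
noncomputable def charPolynomial : Polynomial ℤ :=
  ∑ s : L, Polynomial.C (IncidenceAlgebra.mu ℤ (⊥ : L) s) *
    Polynomial.X ^ (grade ℕ (⊤ : L) - grade ℕ s)

end LatticeInvariants

section RankMetric

variable (F E : Type*) [Field F] [Field E] [Algebra F E]

/-- The rank of a vector over the extension `E` of `F`: the dimension over `F` of the `F`-span of
its entries. -/
noncomputable def vectorRank {n : ℕ} (v : Fin n → E) : ℕ :=
  Module.finrank F (Submodule.span F (Set.range v))

/-- The vectors in `E ^ n` of rank at most `i`. -/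
def lowRankVectors (i n : ℕ) : Set (Fin n → E) :=
  {v | vectorRank F E v ≤ i}

/-- The rank-metric lattice: the `E`-subspaces of `E ^ n` of the form `⟨v₁, …, v_ℓ⟩` with `ℓ ≥ 1`
and `v₁, …, v_ℓ` of rank at most `i` over `F`, ordered by inclusion. For `F` with `q` elements and
`E` of degree `m` over `F` this is `ℒ_i(n, m; q)`. -/
@[ext]
structure RankMetricLattice (i n : ℕ) where
  /-- The underlying `E`-subspace of `E ^ n`. -/
  carrier : Submodule E (Fin n → E)
  /-- It is spanned by a non-empty finite family of vectors of rank at most `i`. -/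
  exists_span : ∃ (l : ℕ) (v : Fin l → Fin n → E),
    1 ≤ l ∧ (∀ k, v k ∈ lowRankVectors F E i n) ∧ carrier = Submodule.span E (Set.range v)

namespace RankMetricLattice

variable {F E} {i n : ℕ}

instance : PartialOrder (RankMetricLattice F E i n) :=
  PartialOrder.lift carrier fun _ _ h => RankMetricLattice.ext h

theorem le_iff {U V : RankMetricLattice F E i n} : U ≤ V ↔ U.carrier ≤ V.carrier := Iff.rfl

theorem lt_iff {U V : RankMetricLattice F E i n} : U < V ↔ U.carrier < V.carrier := Iff.rfl

theorem zero_mem_lowRankVectors : (0 : Fin n → E) ∈ lowRankVectors F E i n := by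
  have h : Submodule.span F (Set.range (0 : Fin n → E)) = ⊥ := by
    rw [Submodule.span_eq_bot]
    rintro _ ⟨k, rfl⟩
    rfl
  change Module.finrank F (Submodule.span F (Set.range (0 : Fin n → E))) ≤ i
  rw [h, finrank_bot]
  exact Nat.zero_le i

theorem eq_span (U : RankMetricLattice F E i n) :
    U.carrier = Submodule.span E {x | x ∈ U.carrier ∧ x ∈ lowRankVectors F E i n} := by
  obtain ⟨U, l, v, hl, hv, rfl⟩ := U
  dsimp only
  apply le_antisymm
  · rw [Submodule.span_le]
    rintro _ ⟨k, rfl⟩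
    exact Submodule.subset_span ⟨Submodule.subset_span ⟨k, rfl⟩, hv k⟩
  · rw [Submodule.span_le]
    exact fun x hx => hx.1

section FiniteField

variable [Finite E]

/-- The `E`-span of any set of vectors of rank at most `i`, as an element of the lattice. -/
def ofSet (S : Set (Fin n → E)) (hS : S ⊆ lowRankVectors F E i n) : RankMetricLattice F E i n :=
  ⟨Submodule.span E S, by
    obtain ⟨l, ⟨f⟩⟩ := Finite.exists_equiv_fin (insert (0 : Fin n → E) S : Set (Fin n → E))
    refine ⟨l, fun k => (f.symm k).1, ?_, ?_, ?_⟩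
    · have : 0 < l := (f ⟨0, Set.mem_insert _ _⟩).pos
      omega
    · exact fun k => Set.insert_subset zero_mem_lowRankVectors hS (f.symm k).2
    · have h : Set.range (fun k => (f.symm k).1) = insert (0 : Fin n → E) S := by
        ext x
        constructor
        · rintro ⟨k, rfl⟩
          exact (f.symm k).2
        · intro hx
          exact ⟨f ⟨x, hx⟩, by simp⟩
      rw [h, Submodule.span_insert_zero]⟩

/-- The join is the sum of subspaces, the meet of `U` and `V` is the span of the vectors of rank
at most `i` in `U ∩ V`. -/
instance : Lattice (RankMetricLattice F E i n) where
  sup U V := ofSet ({x | x ∈ U.carrier ∧ x ∈ lowRankVectors F E i n} ∪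
    {x | x ∈ V.carrier ∧ x ∈ lowRankVectors F E i n}) (by rintro x (h | h) <;> exact h.2)
  le_sup_left U V := by
    exact (eq_span U).le.trans (Submodule.span_mono Set.subset_union_left)
  le_sup_right U V := by
    exact (eq_span V).le.trans (Submodule.span_mono Set.subset_union_right)
  sup_le U V W hU hV := by
    refine Submodule.span_le.2 ?_
    rintro x (h | h)
    · exact hU h.1
    · exact hV h.1
  inf U V := ofSet {x | (x ∈ U.carrier ∧ x ∈ V.carrier) ∧ x ∈ lowRankVectors F E i n} fun _ h => h.2
  inf_le_left U V := Submodule.span_le.2 fun _ h => h.1.1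
  inf_le_right U V := Submodule.span_le.2 fun _ h => h.1.2
  le_inf U V W hU hV := by
    refine (eq_span U).le.trans (Submodule.span_mono fun x h => ?_)
    exact ⟨⟨hU h.1, hV h.1⟩, h.2⟩

instance : BoundedOrder (RankMetricLattice F E i n) where
  bot := ofSet ∅ (Set.empty_subset _)
  bot_le U := Submodule.span_le.2 (Set.empty_subset _)
  top := ofSet (lowRankVectors F E i n) subset_rfl
  le_top U := by
    exact (eq_span U).le.trans (Submodule.span_mono fun x h => h.2)

theorem coe_sup (U V : RankMetricLattice F E i n) : (U ⊔ V).carrier = U.carrier ⊔ V.carrier := by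
  refine (Submodule.span_union _ _).trans ?_
  rw [← eq_span U, ← eq_span V]

theorem coe_bot : (⊥ : RankMetricLattice F E i n).carrier = ⊥ := Submodule.span_empty

instance : Finite (RankMetricLattice F E i n) :=
  Finite.of_injective carrier fun _ _ h => RankMetricLattice.ext h

noncomputable instance : Fintype (RankMetricLattice F E i n) := Fintype.ofFinite _

noncomputable instance : DecidableEq (RankMetricLattice F E i n) := Classical.decEq _

noncomputable instance : LocallyFiniteOrder (RankMetricLattice F E i n) := by
  classical exact Fintype.toLocallyFiniteOrder

/-- The rank-metric lattice is graded by the dimension over `E`. -/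
noncomputable instance : GradeMinOrder ℕ (RankMetricLattice F E i n) where
  grade U := Module.finrank E U.carrier
  grade_strictMono _ _ h := Submodule.finrank_lt_finrank_of_lt (lt_iff.1 h)
  covBy_grade U V h := by
    rw [Nat.covBy_iff_add_one_eq]
    have hlt : U.carrier < V.carrier := lt_iff.1 h.1
    obtain ⟨x, hxV, hxU⟩ : ∃ x, (x ∈ V.carrier ∧ x ∈ lowRankVectors F E i n) ∧ x ∉ U.carrier := by
      by_contra! hcon
      refine hlt.not_ge ?_
      rw [eq_span V, Submodule.span_le]
      exact hcon
    have hW : (U ⊔ ofSet {x} (Set.singleton_subset_iff.2 hxV.2)) = V := by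
      refine (h.eq_or_eq le_sup_left (sup_le h.1.le ?_)).resolve_left ?_
      · exact Submodule.span_le.2 (Set.singleton_subset_iff.2 hxV.1)
      · intro he
        have h1 := (le_sup_right : _ ≤ U ⊔ ofSet {x} (Set.singleton_subset_iff.2 hxV.2))
        rw [he] at h1
        exact hxU (h1 (Submodule.subset_span rfl))
    have h2 : V.carrier = U.carrier ⊔ Submodule.span E {x} := by
      conv_lhs => rw [← hW]
      rw [coe_sup]
      rfl
    have h3 : Module.finrank E V.carrier ≤ Module.finrank E U.carrier + 1 := by
      rw [h2]
      exact (Submodule.finrank_add_le_finrank_add_finrank _ _).trans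
        (Nat.add_le_add_left ((finrank_span_le_card ({x} : Set (Fin n → E))).trans (by simp)) _)
    have h4 := Submodule.finrank_lt_finrank_of_lt hlt
    omega
  isMin_grade U h := by
    have : U = ⊥ := h.eq_bot
    rw [this, coe_bot, finrank_bot]
    exact isMin_bot

theorem grade_eq_finrank (U : RankMetricLattice F E i n) :
    grade ℕ U = Module.finrank E U.carrier := rfl

end FiniteField

end RankMetricLattice

end RankMetric

/-! ### Counting vectors over `E` by rank -/

section Counting

open Module Finset
open scoped Classical

variable {F : Type*} [Field F]

/-! Write `Q = q ^ 4` for the order of `E`, and call a vector low-rank if its rank is at most `2`.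
The number `w₁` only needs the count of low-rank vectors, and `w₃`, `w₄` follow from `w₀`, `w₁`,
`w₂` because the characteristic polynomial vanishes at `1` and at `Q`. The root `1` is the defining
property of the Möbius function. The root `Q` comes from the critical-problem argument
(`sum_mu_mul_pow`): `Q ^ (4 - dim s)` counts the functionals that vanish on `s`, and Möbius
summation leaves only functionals with no nonzero low-rank vector in the kernel. There are none,
since every hyperplane meets the plane of the first two coordinates, where all vectors are low-rank.

The work is in `w₂`. An element `U` of dimension two with `N` atoms below it has `μ(0, U) = N - 1`.
If `v` is a nonzero low-rank vector of `U` and `w` lies in `U` outside `E v`, exactly `N - 1` shifts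
`w + c v` are low-rank. Giving the pair `(v, w)` the weight `(N - 1) / N` makes `U` contribute `(Q -
1) ^ 2 * Q * (N - 1)` in all, while pairs whose span is not in the lattice get weight `0`. The sum
over `U` thus becomes a sum over all pairs of vectors (`whitneyFirst_two_mul`), with inner sum
`shiftSum`.

The inner sum is invariant under invertible matrices over `F`, so `v` may be taken as `(b, 0)` with
`b` independent of length `1` or `2`. Splitting `w = (u, t)`, the contribution is governed by `T`,
the `F`-span of `t`. The delicate case is `b` of length `2` and `dim T = 2`. There the number of `c`
with `c b` inside `T` is `1`, unless `T` is a multiple of the plane spanned by `b`; then it is the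
order of the field of scalars stabilising that plane. This field has order `q` or `q ^ 2`, the
latter exactly when `b 1 / b 0` lies in the quadratic extension of `F`. Counting both kinds of `b`
gives a rational expression in `q` that collapses to the stated polynomial (`sum_shiftSum`). -/

theorem linearIndependent_of_span_eq {V : Type*} [AddCommGroup V] [Module F V] {k : ℕ}
    {W : Submodule F V} (hW : finrank F W = k) {b : Fin k → V}
    (hb : Submodule.span F (Set.range b) = W) : LinearIndependent F b := by
  rw [linearIndependent_iff_card_eq_finrank_span, Set.finrank, hb, hW, Fintype.card_fin]

theorem span_eq_of_linearIndependent {V : Type*} [AddCommGroup V] [Module F V] [Finite V] {k : ℕ}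
    {W : Submodule F V} (hW : finrank F W = k) {b : Fin k → V}
    (hb : LinearIndependent F b) (hbW : ∀ i, b i ∈ W) : Submodule.span F (Set.range b) = W := by
  refine Submodule.eq_of_le_of_finrank_eq (Submodule.span_le.2 ?_) ?_
  · rintro _ ⟨i, rfl⟩
    exact hbW i
  · rw [finrank_span_eq_card hb, hW, Fintype.card_fin]

theorem exists_linearIndependent_append {V : Type*} [AddCommGroup V] [Module F V] {r : ℕ}
    {M : Fin r → V} (hM : LinearIndependent F M) (k : ℕ) (hk : r + k ≤ finrank F V) :
    ∃ K : Fin k → V, LinearIndependent F (Fin.append M K) := by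
  induction k with
  | zero =>
    refine ⟨Fin.elim0, ?_⟩
    rw [Fin.append_elim0]
    exact hM
  | succ k ih =>
    obtain ⟨K, hK⟩ := ih (by omega)
    obtain ⟨x, hx⟩ := exists_linearIndependent_snoc_of_lt_finrank hK (by omega)
    exact ⟨Fin.snoc K x, by rw [Fin.append_snoc]; exact hx⟩

variable {E : Type*} [Field E] [Algebra F E]

/-- The row vector `b M` with entries in `E`, for a matrix `M` over `F`. -/
def scalarVecMul {r m : ℕ} (b : Fin r → E) (M : Matrix (Fin r) (Fin m) F) : Fin m → E :=
  Matrix.vecMul b (M.map (algebraMap F E))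

theorem scalarVecMul_apply {r m : ℕ} (b : Fin r → E) (M : Matrix (Fin r) (Fin m) F) (j : Fin m) :
    scalarVecMul b M j = ∑ i, M i j • b i := by
  simp [scalarVecMul, Matrix.vecMul, dotProduct, Algebra.smul_def, mul_comm]

theorem scalarVecMul_mul {r m l : ℕ} (b : Fin r → E) (M : Matrix (Fin r) (Fin m) F)
    (N : Matrix (Fin m) (Fin l) F) :
    scalarVecMul (scalarVecMul b M) N = scalarVecMul b (M * N) := by
  simp [scalarVecMul, Matrix.vecMul_vecMul, Matrix.map_mul]

theorem scalarVecMul_one {r : ℕ} (b : Fin r → E) :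
    scalarVecMul b (1 : Matrix (Fin r) (Fin r) F) = b := by
  simp [scalarVecMul]

theorem scalarVecMul_injective {r m : ℕ} {b : Fin r → E} (hb : LinearIndependent F b) :
    Function.Injective (scalarVecMul b : Matrix (Fin r) (Fin m) F → Fin m → E) := by
  intro M N h
  ext i j
  have hj := congrFun h j
  rw [scalarVecMul_apply, scalarVecMul_apply] at hj
  exact Fintype.linearIndependent_iff.1 hb (fun i => M i j - N i j)
    (by simp [sub_smul, hj]) i |> sub_eq_zero.1

theorem span_scalarVecMul_le {r m : ℕ} (b : Fin r → E) (M : Matrix (Fin r) (Fin m) F) :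
    Submodule.span F (Set.range (scalarVecMul b M)) ≤ Submodule.span F (Set.range b) := by
  rw [Submodule.span_le]
  rintro _ ⟨j, rfl⟩
  rw [scalarVecMul_apply]
  exact Submodule.sum_mem _ fun i _ =>
    Submodule.smul_mem _ _ (Submodule.subset_span ⟨i, rfl⟩)

theorem exists_scalarVecMul_eq {r m : ℕ} {b : Fin r → E} {v : Fin m → E}
    (h : Submodule.span F (Set.range v) ≤ Submodule.span F (Set.range b)) :
    ∃ M : Matrix (Fin r) (Fin m) F, scalarVecMul b M = v := by
  have : ∀ j, ∃ c : Fin r → F, ∑ i, c i • b i = v j := fun j =>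
    (Submodule.mem_span_range_iff_exists_fun F).1 (h (Submodule.subset_span ⟨j, rfl⟩))
  choose c hc using this
  exact ⟨Matrix.of fun i j => c j i, funext fun j => by simp [scalarVecMul_apply, hc]⟩

theorem linearIndependent_of_mul_eq_one {r m : ℕ} {M : Matrix (Fin r) (Fin m) F}
    {N : Matrix (Fin m) (Fin r) F} (h : M * N = 1) : LinearIndependent F fun i => M i := by
  refine Matrix.vecMul_injective_iff.1 (Function.LeftInverse.injective (g := fun x => Matrix.vecMul x N) ?_)
  intro x
  simp [Matrix.vecMul_vecMul, h]

theorem exists_mul_eq_one {r m : ℕ} {M : Matrix (Fin r) (Fin m) F}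
    (h : LinearIndependent F fun i => M i) : ∃ N : Matrix (Fin m) (Fin r) F, M * N = 1 := by
  rw [← Matrix.mulVec_surjective_iff_exists_right_inverse]
  have h1 : M.rank = Fintype.card (Fin r) := LinearIndependent.rank_matrix h
  have h2 : LinearMap.range M.mulVecLin = ⊤ := by
    apply Submodule.eq_top_of_finrank_eq
    rw [← Matrix.rank, h1]
    simp
  exact LinearMap.range_eq_top.1 h2

theorem span_scalarVecMul {r m : ℕ} (b : Fin r → E) {M : Matrix (Fin r) (Fin m) F}
    (h : LinearIndependent F fun i => M i) :
    Submodule.span F (Set.range (scalarVecMul b M)) = Submodule.span F (Set.range b) := by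
  refine le_antisymm (span_scalarVecMul_le b M) ?_
  obtain ⟨N, hN⟩ := exists_mul_eq_one h
  conv_lhs => rw [← scalarVecMul_one (F := F) b, ← hN, ← scalarVecMul_mul]
  exact span_scalarVecMul_le _ N

theorem vectorRank_scalarVecMul {r m : ℕ} (b : Fin r → E) {M : Matrix (Fin r) (Fin m) F}
    (h : LinearIndependent F fun i => M i) :
    vectorRank F E (scalarVecMul b M) = vectorRank F E b := by
  rw [vectorRank, vectorRank, span_scalarVecMul b h]

theorem vectorRank_eq_iff_linearIndependent {r : ℕ} {b : Fin r → E} :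
    vectorRank F E b = r ↔ LinearIndependent F b := by
  rw [linearIndependent_iff_card_eq_finrank_span, Fintype.card_fin, eq_comm]
  rfl

theorem scalarVecMul_append {r k m : ℕ} (b : Fin r → E) (M : Fin r → Fin m → F)
    (K : Fin k → Fin m → F) :
    scalarVecMul (Fin.append b 0) (Matrix.of (Fin.append M K)) = scalarVecMul b (Matrix.of M) := by
  ext j
  simp [scalarVecMul_apply, Fin.sum_univ_add]

variable [Fintype F]

theorem card_linearIndependent_filter {V : Type*} [AddCommGroup V] [Module F V] [Fintype V] {k n : ℕ}
    (hn : finrank F V = n) (hk : k ≤ n) :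
    ((univ.filter fun s : Fin k → V => LinearIndependent F s).card : ℚ) =
      ∏ i : Fin k, ((Fintype.card F : ℚ) ^ n - (Fintype.card F : ℚ) ^ (i : ℕ)) := by
  subst hn
  have h := card_linearIndependent (K := F) (V := V) hk
  rw [Nat.card_eq_fintype_card, Fintype.card_subtype] at h
  rw [h, Nat.cast_prod]
  refine prod_congr rfl fun i _ => ?_
  rw [Nat.cast_sub]
  · push_cast; rfl
  · exact Nat.pow_le_pow_right Fintype.card_pos (i.2.le.trans hk)

theorem card_filter_span_eq {V : Type*} [AddCommGroup V] [Module F V] [Fintype V] {k : ℕ}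
    {W : Submodule F V} (hW : finrank F W = k) :
    ((univ.filter fun b : Fin k → V => Submodule.span F (Set.range b) = W).card : ℚ) =
      ∏ i : Fin k, ((Fintype.card F : ℚ) ^ k - (Fintype.card F : ℚ) ^ (i : ℕ)) := by
  rw [← card_linearIndependent_filter hW le_rfl]
  norm_cast
  symm
  refine card_bij (fun s _ i => (s i : V)) ?_ ?_ ?_
  · intro s hs
    simp only [mem_filter, mem_univ, true_and] at hs ⊢
    exact span_eq_of_linearIndependent hW
      (hs.map' W.subtype (Submodule.ker_subtype W)) fun i => (s i).2
  · intro s _ t _ h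
    ext i
    exact congrFun h i
  · intro b hb
    simp only [mem_filter, mem_univ, true_and] at hb
    have hmem : ∀ i, b i ∈ W := fun i => hb ▸ Submodule.subset_span ⟨i, rfl⟩
    refine ⟨fun i => ⟨b i, hmem i⟩, ?_, rfl⟩
    simp only [mem_filter, mem_univ, true_and]
    exact LinearIndependent.of_comp W.subtype (linearIndependent_of_span_eq hW hb)

variable [Fintype E]

/-- A factorisation `v = b M` is an ordered basis `b` of the span of the entries of `v` together
with the coordinates of the entries in it, and these are unique. The fibre therefore has the size of
`GL_r(F)`. -/
theorem card_filter_scalarVecMul_eq {r m : ℕ} (v : Fin m → E) :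
    (((univ.filter fun p : Matrix (Fin r) (Fin m) F × (Fin r → E) =>
      (LinearIndependent F fun i => p.1 i) ∧ LinearIndependent F p.2).filter
        fun p => scalarVecMul p.2 p.1 = v).card : ℚ) =
      if vectorRank F E v = r then
        ∏ i : Fin r, ((Fintype.card F : ℚ) ^ r - (Fintype.card F : ℚ) ^ (i : ℕ)) else 0 := by
  split_ifs with hv
  · rw [← card_filter_span_eq (W := Submodule.span F (Set.range v)) hv]
    norm_cast
    refine card_bij (fun p _ => p.2) ?_ ?_ ?_
    · rintro ⟨M, b⟩ h
      simp only [mem_filter, mem_univ, true_and] at h ⊢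
      rw [← h.2, span_scalarVecMul b h.1.1]
    · rintro ⟨M, b⟩ h ⟨M', b'⟩ h' (rfl : b = b')
      simp only [mem_filter, mem_univ, true_and] at h h'
      rw [scalarVecMul_injective h.1.2 (h.2.trans h'.2.symm)]
    · intro b hb
      simp only [mem_filter, mem_univ, true_and] at hb
      have hb' := linearIndependent_of_span_eq hv hb
      obtain ⟨M, hM⟩ := exists_scalarVecMul_eq hb.ge
      obtain ⟨N, hN⟩ := exists_scalarVecMul_eq hb.le
      refine ⟨(M, b), ?_, rfl⟩
      simp only [mem_filter, mem_univ, true_and]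
      -- `b (M N) = v N = b`, and uniqueness of coordinates gives `M N = 1`.
      refine ⟨⟨linearIndependent_of_mul_eq_one (N := N) (scalarVecMul_injective hb' ?_), hb'⟩, hM⟩
      rw [← scalarVecMul_mul, hM, hN, scalarVecMul_one]
  · rw [Nat.cast_eq_zero, card_eq_zero, filter_eq_empty_iff]
    rintro ⟨M, b⟩ h rfl
    simp only [mem_filter, mem_univ, true_and] at h
    exact hv ((vectorRank_scalarVecMul b h.1).trans (vectorRank_eq_iff_linearIndependent.2 h.2))

/-- Moves a sum over vectors of rank `r` to pairs `(M, b)`, where `f` may depend on `b` alone; the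
factor is the constant fibre size. -/
theorem sum_vectorRank_eq {r m : ℕ} (f : (Fin m → E) → ℚ) :
    (∑ v : Fin m → E with vectorRank F E v = r, f v) *
        ∏ i : Fin r, ((Fintype.card F : ℚ) ^ r - (Fintype.card F : ℚ) ^ (i : ℕ)) =
      ∑ M : Matrix (Fin r) (Fin m) F with LinearIndependent F fun i => M i,
        ∑ b : Fin r → E with LinearIndependent F b, f (scalarVecMul b M) := by
  have h1 : ∑ M : Matrix (Fin r) (Fin m) F with LinearIndependent F fun i => M i,
        ∑ b : Fin r → E with LinearIndependent F b, f (scalarVecMul b M) =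
      ∑ p : Matrix (Fin r) (Fin m) F × (Fin r → E) with
      (LinearIndependent F fun i => p.1 i) ∧ LinearIndependent F p.2, f (scalarVecMul p.2 p.1) := by
    rw [← sum_product']
    refine sum_congr ?_ fun _ _ => rfl
    ext ⟨M, b⟩
    simp only [mem_product, mem_filter, mem_univ, true_and]
  rw [h1, ← sum_fiberwise _ (fun p : Matrix (Fin r) (Fin m) F × (Fin r → E) => scalarVecMul p.2 p.1),
    sum_mul, sum_filter]
  refine sum_congr rfl fun v _ => ?_
  rw [sum_congr rfl fun p hp => congrArg f (mem_filter.1 hp).2, sum_const, nsmul_eq_mul,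
    card_filter_scalarVecMul_eq]
  split_ifs <;> ring

theorem card_vectorRank_eq {r m n : ℕ} (hE : finrank F E = n) (hr : r ≤ m) (hr' : r ≤ n) :
    ((univ.filter fun v : Fin m → E => vectorRank F E v = r).card : ℚ) *
        ∏ i : Fin r, ((Fintype.card F : ℚ) ^ r - (Fintype.card F : ℚ) ^ (i : ℕ)) =
      (∏ i : Fin r, ((Fintype.card F : ℚ) ^ m - (Fintype.card F : ℚ) ^ (i : ℕ))) *
        ∏ i : Fin r, ((Fintype.card F : ℚ) ^ n - (Fintype.card F : ℚ) ^ (i : ℕ)) := by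
  have h := sum_vectorRank_eq (F := F) (r := r) (m := m) (E := E) fun _ => 1
  simp only [sum_const, nsmul_eq_mul, mul_one] at h
  rw [h, card_linearIndependent_filter hE hr',
    ← card_linearIndependent_filter (F := F) (V := Fin m → F) (n := m) (by simp) hr]
  rfl

end Counting

/-! ### The inner sum: reduction to a span `T` -/

section Shifts

open Module Finset
open scoped Classical

variable {F E : Type*} [Field F] [Field E] [Algebra F E]

theorem scalarVecMul_add_smul {r m : ℕ} (v w : Fin r → E) (c : E) (P : Matrix (Fin r) (Fin m) F) :
    scalarVecMul w P + c • scalarVecMul v P = scalarVecMul (w + c • v) P := by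
  simp [scalarVecMul, Matrix.add_vecMul, Matrix.smul_vecMul]

variable (F) [Fintype E]

/-- The number of scalars `c` for which `w + c v` has rank at most `2`. -/
noncomputable def shiftCount {n : ℕ} (v w : Fin n → E) : ℕ :=
  #{c : E | vectorRank F E (w + c • v) ≤ 2}

/-- The sum over all `w` of `N / (1 + N)`, where `N` is the number of shifts `w + c v` of rank at
most `2`. -/
noncomputable def shiftSum {n : ℕ} (v : Fin n → E) : ℚ :=
  ∑ w : Fin n → E, (shiftCount F v w : ℚ) / (1 + shiftCount F v w)

/-- The number of scalars `c` for which `u + c b` together with `T` spans a space of dimension at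
most `2`. -/
noncomputable def relShiftCount {r : ℕ} (T : Submodule F E) (b u : Fin r → E) : ℕ :=
  #{c : E | finrank F ↥(Submodule.span F (Set.range (u + c • b)) ⊔ T) ≤ 2}

/-- The contribution to `shiftSum` of the vectors whose last entries span `T`. -/
noncomputable def relShiftSum {r : ℕ} (T : Submodule F E) (b : Fin r → E) : ℚ :=
  ∑ u : Fin r → E, (relShiftCount F T b u : ℚ) / (1 + relShiftCount F T b u)

/-- The number of scalars `c` for which all entries of `u + c b` lie in `T`. -/
noncomputable def shiftsInto {r : ℕ} (T : Submodule F E) (b u : Fin r → E) : ℕ :=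
  #{c : E | ∀ i, (u + c • b) i ∈ T}

variable {F}

/-- An invertible matrix over `F` preserves rank and commutes with scalars of `E`, so `w ↦ w P`
permutes the terms. -/
theorem shiftSum_scalarVecMul {n : ℕ} (v : Fin n → E) {P : Matrix (Fin n) (Fin n) F}
    (hP : LinearIndependent F fun i => P i) : shiftSum F (scalarVecMul v P) = shiftSum F v := by
  obtain ⟨N, hN⟩ := exists_mul_eq_one hP
  have hbij : Function.Bijective fun w : Fin n → E => scalarVecMul w P := by
    refine Finite.injective_iff_bijective.1
      (Function.LeftInverse.injective (g := fun w => scalarVecMul w N) fun w => ?_)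
    simp only [scalarVecMul_mul, hN, scalarVecMul_one]
  unfold shiftSum
  rw [← hbij.sum_comp fun w => (shiftCount F (scalarVecMul v P) w : ℚ) /
    (1 + shiftCount F (scalarVecMul v P) w)]
  have h : ∀ w : Fin n → E, shiftCount F (scalarVecMul v P) (scalarVecMul w P) =
      shiftCount F v w := fun w => by
    simp only [shiftCount, scalarVecMul_add_smul, vectorRank_scalarVecMul _ hP]
  simp only [h]

/-- Complete `M` by further rows to an invertible matrix `P`; then `b M = (b, 0) P`. -/
theorem shiftSum_scalarVecMul_append {r k : ℕ} (b : Fin r → E) {M : Matrix (Fin r) (Fin (r + k)) F}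
    (hM : LinearIndependent F fun i => M i) :
    shiftSum F (scalarVecMul b M) = shiftSum F (Fin.append b (0 : Fin k → E)) := by
  obtain ⟨K, hK⟩ := exists_linearIndependent_append hM k (by simp)
  exact (congrArg _ (scalarVecMul_append b (fun i => M i) K)).symm.trans
    (shiftSum_scalarVecMul _ hK)

/-- Adding a multiple of `(b, 0)` to `w = (u, t)` leaves `t` fixed, so the rank of a shift sees `t`
only through its span. -/
theorem shiftSum_append {r k : ℕ} (b : Fin r → E) :
    shiftSum F (Fin.append b (0 : Fin k → E)) =
      ∑ t : Fin k → E, relShiftSum F (Submodule.span F (Set.range t)) b := by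
  have h : ∀ (u : Fin r → E) (t : Fin k → E), shiftCount F (Fin.append b (0 : Fin k → E))
      (Fin.append u t) = relShiftCount F (Submodule.span F (Set.range t)) b u := by
    intro u t
    refine congrArg Finset.card (filter_congr fun c _ => ?_)
    have h1 : Fin.append u t + c • Fin.append b (0 : Fin k → E) = Fin.append (u + c • b) t := by
      ext i
      refine Fin.addCases (fun i => ?_) (fun i => ?_) i <;> simp
    have h2 : Set.range (Fin.append (u + c • b) t) = Set.range (u + c • b) ∪ Set.range t := by
      ext x
      simp only [Set.mem_range, Set.mem_union]
      constructor
      · rintro ⟨i, rfl⟩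
        refine Fin.addCases (fun i => ?_) (fun i => ?_) i
        · exact Or.inl ⟨i, by simp⟩
        · exact Or.inr ⟨i, by simp⟩
      · rintro (⟨i, rfl⟩ | ⟨i, rfl⟩)
        · exact ⟨Fin.castAdd k i, by simp⟩
        · exact ⟨Fin.natAdd r i, by simp⟩
    rw [h1, vectorRank, h2, Submodule.span_union]
  unfold shiftSum relShiftSum
  rw [← (Fin.appendEquiv r k).sum_comp, Fintype.sum_prod_type_right]
  exact sum_congr rfl fun t _ => sum_congr rfl fun u _ => by rw [← h]; rfl

theorem relShiftSum_of_add_le {r : ℕ} {T : Submodule F E} (b : Fin r → E)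
    (h : finrank F T + r ≤ 2) :
    relShiftSum F T b = (Fintype.card E : ℚ) ^ r * (Fintype.card E / (1 + Fintype.card E)) := by
  have h1 : ∀ u, relShiftCount F T b u = Fintype.card E := by
    intro u
    unfold relShiftCount
    rw [filter_true_of_mem, card_univ]
    intro c _
    refine (Submodule.finrank_add_le_finrank_add_finrank _ _).trans ?_
    have := finrank_range_le_card (R := F) (u + c • b)
    rw [Fintype.card_fin] at this
    unfold Set.finrank at this
    omega
  simp [relShiftSum, h1]

theorem relShiftSum_of_three_le {r : ℕ} {T : Submodule F E} (b : Fin r → E)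
    (h : 3 ≤ finrank F T) : relShiftSum F T b = 0 := by
  have h1 : ∀ u, relShiftCount F T b u = 0 := by
    intro u
    unfold relShiftCount
    rw [card_eq_zero, filter_eq_empty_iff]
    intro c _ hc
    have := Submodule.finrank_mono (R := F)
      (le_sup_right : T ≤ Submodule.span F (Set.range (u + c • b)) ⊔ T)
    omega
  simp [relShiftSum, h1]

theorem one_le_shiftsInto_zero {r : ℕ} (T : Submodule F E) (b : Fin r → E) :
    1 ≤ shiftsInto F T b 0 :=
  card_pos.2 ⟨0, by simp⟩

/-- The admissible `c` for `u`, if there are any, form a coset of the additive group of admissible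
`c` for `0`. -/
theorem shiftsInto_eq {r : ℕ} {T : Submodule F E} {b u : Fin r → E}
    (h : shiftsInto F T b u ≠ 0) : shiftsInto F T b u = shiftsInto F T b 0 := by
  obtain ⟨c₀, hc₀⟩ := card_pos.1 (Nat.pos_of_ne_zero h)
  simp only [mem_filter, mem_univ, true_and, Pi.add_apply, Pi.smul_apply] at hc₀
  refine card_bij' (fun c _ => c - c₀) (fun c _ => c + c₀) ?_ ?_ (by simp) (by simp)
  · intro c hc
    simp only [mem_filter, mem_univ, true_and, Pi.add_apply, Pi.smul_apply, Pi.zero_apply,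
      zero_add] at hc ⊢
    intro i
    have := T.sub_mem (hc i) (hc₀ i)
    rwa [add_sub_add_left_eq_sub, ← sub_smul] at this
  · intro c hc
    simp only [mem_filter, mem_univ, true_and, Pi.add_apply, Pi.smul_apply, Pi.zero_apply,
      zero_add] at hc ⊢
    intro i
    have := T.add_mem (hc i) (hc₀ i)
    rwa [add_left_comm, ← add_smul] at this

/-- Double count of pairs `(u, c)`: for fixed `c`, translation by `c b` matches the admissible `u`
with the vectors over `T`. -/
theorem sum_shiftsInto {r : ℕ} (T : Submodule F E) (b : Fin r → E) :
    ∑ u : Fin r → E, shiftsInto F T b u = Fintype.card E * Nat.card T ^ r := by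
  have h : ∀ c : E, #{u : Fin r → E | ∀ i, (u + c • b) i ∈ T} = Nat.card T ^ r := by
    intro c
    have hT : Nat.card T ^ r = #(univ : Finset (Fin r → T)) := by
      rw [card_univ, ← Nat.card_eq_fintype_card, Nat.card_fun, Nat.card_fin]
    rw [hT]
    refine card_bij' (fun u hu i => ⟨(u + c • b) i, (mem_filter.1 hu).2 i⟩)
      (fun t _ i => t i - (c • b) i) ?_ ?_ ?_ ?_
    · simp
    · simp
    · intro u _
      ext i
      simp
    · intro t _
      ext i
      simp
  unfold shiftsInto
  have := sum_card_bipartiteAbove_eq_sum_card_bipartiteBelow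
    (fun (u : Fin r → E) (c : E) => ∀ i, (u + c • b) i ∈ T) (s := univ) (t := univ)
  simp only [bipartiteAbove, bipartiteBelow, h] at this
  rw [this, sum_const, card_univ, smul_eq_mul]

/-- The count takes only the value `0` and its value `m` at `u = 0`. Its total then shows that `m`
occurs `Q |T| ^ r / m` times. -/
theorem sum_comp_shiftsInto {r : ℕ} (T : Submodule F E) (b : Fin r → E) (g : ℕ → ℚ) :
    ∑ u : Fin r → E, g (shiftsInto F T b u) =
      ((Fintype.card E : ℚ) ^ r - Fintype.card E * (Nat.card T : ℚ) ^ r / shiftsInto F T b 0) * g 0 +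
        Fintype.card E * (Nat.card T : ℚ) ^ r / shiftsInto F T b 0 * g (shiftsInto F T b 0) := by
  set m := shiftsInto F T b 0
  have hm : (m : ℚ) ≠ 0 := by
    have := one_le_shiftsInto_zero T b
    positivity
  have h1 : ∀ u, (shiftsInto F T b u : ℚ) = (if shiftsInto F T b u = 0 then 0 else 1) * m := by
    intro u
    split_ifs with h
    · simp [h]
    · simp [shiftsInto_eq h, m]
  have h2 : ∀ u, g (shiftsInto F T b u) = (if shiftsInto F T b u = 0 then (0 : ℚ) else 1) *
      (g m - g 0) + g 0 := by
    intro u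
    split_ifs with h
    · simp [h]
    · simp [shiftsInto_eq h, m]
  have h3 : (∑ u : Fin r → E, if shiftsInto F T b u = 0 then (0 : ℚ) else 1) =
      Fintype.card E * (Nat.card T : ℚ) ^ r / m := by
    rw [eq_div_iff hm, sum_mul, ← sum_congr rfl fun u _ => h1 u]
    exact_mod_cast sum_shiftsInto T b
  rw [sum_congr rfl fun u _ => h2 u, sum_add_distrib, ← sum_mul, h3]
  simp
  ring

/-- Since `T` already has dimension two, a shift is admissible only if its entries lie in `T`. The
value `m` occurs `Q |T| ^ r / m` times with weight `m / (1 + m)`, and a factor `m` cancels. -/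
theorem relShiftSum_of_finrank_eq_two {r : ℕ} {T : Submodule F E} (b : Fin r → E)
    (h : finrank F T = 2) :
    relShiftSum F T b =
      Fintype.card E * (Nat.card T : ℚ) ^ r / (1 + shiftsInto F T b 0) := by
  have h1 : ∀ u, relShiftCount F T b u = shiftsInto F T b u := by
    intro u
    unfold relShiftCount shiftsInto
    congr 1
    ext c
    simp only [mem_filter, mem_univ, true_and]
    constructor
    · intro hc i
      have := Submodule.eq_of_le_of_finrank_le
        (le_sup_right : T ≤ Submodule.span F (Set.range (u + c • b)) ⊔ T) (hc.trans h.ge)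
      rw [this]
      exact Submodule.mem_sup_left (Submodule.subset_span ⟨i, rfl⟩)
    · intro hc
      rw [sup_eq_right.2, h]
      rw [Submodule.span_le]
      rintro _ ⟨i, rfl⟩
      exact hc i
  have hm : (shiftsInto F T b 0 : ℚ) ≠ 0 := by
    have := one_le_shiftsInto_zero T b
    positivity
  unfold relShiftSum
  simp only [h1]
  rw [sum_comp_shiftsInto T b fun e => (e : ℚ) / (1 + e)]
  field_simp
  simp

end Shifts

/-! ### The inner sum for two independent entries -/

section Shifts

open Module Finset
open scoped Classical

variable {F E : Type*} [Field F] [Field E] [Algebra F E]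

theorem smul_linearIndependent {r : ℕ} {b : Fin r → E} (hb : LinearIndependent F b) {c : E}
    (hc : c ≠ 0) : LinearIndependent F (c • b) :=
  hb.map' (LinearMap.mulLeft F c) (LinearMap.ker_eq_bot.2 (mul_right_injective₀ hc))

variable [Fintype E]

theorem card_submodule_eq_pow [Fintype F] (T : Submodule F E) :
    Nat.card T = Fintype.card F ^ finrank F T := by
  rw [natCard_eq_pow_finrank (K := F), Nat.card_eq_fintype_card]

theorem shiftsInto_zero_of_finrank_lt {r : ℕ} {T : Submodule F E} {b : Fin r → E}
    (hb : LinearIndependent F b) (h : finrank F T < r) : shiftsInto F T b 0 = 1 := by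
  unfold shiftsInto
  rw [card_eq_one]
  refine ⟨0, ?_⟩
  ext c
  simp only [mem_filter, mem_univ, true_and, mem_singleton, zero_add]
  constructor
  · intro hc
    by_contra h0
    have h1 := finrank_span_eq_card (smul_linearIndependent hb h0)
    have h2 : Submodule.span F (Set.range (c • b)) ≤ T := by
      rw [Submodule.span_le]
      rintro _ ⟨i, rfl⟩
      exact hc i
    have := Submodule.finrank_mono h2
    rw [h1, Fintype.card_fin] at this
    omega
  · rintro rfl i
    simp

/-- Rank-nullity for `(s, t) ↦ ∑ s i • x i + t` on `F ^ 2 × T`: in the kernel, `t` is determined by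
`s`. -/
theorem card_relations [Fintype F] (T : Submodule F E) (x : Fin 2 → E) :
    #{s : Fin 2 → F | ∑ i, s i • x i ∈ T} *
      Fintype.card F ^ finrank F ↥(Submodule.span F (Set.range x) ⊔ T) =
        Fintype.card F ^ (2 + finrank F T) := by
  let Φ : (Fin 2 → F) × T →ₗ[F] E := (Fintype.linearCombination F x).coprod T.subtype
  have h1 : LinearMap.range Φ = Submodule.span F (Set.range x) ⊔ T := by
    rw [LinearMap.range_coprod, Fintype.range_linearCombination, Submodule.range_subtype]
  have h2 := LinearMap.finrank_range_add_finrank_ker Φ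
  rw [h1, finrank_prod, finrank_fin_fun] at h2
  have h3 : #{s : Fin 2 → F | ∑ i, s i • x i ∈ T} = Nat.card (LinearMap.ker Φ) := by
    rw [Nat.card_eq_fintype_card, ← card_univ]
    have hΦ : ∀ p, Φ p = ∑ i, p.1 i • x i + p.2 := fun p => by
      simp [Φ, Fintype.linearCombination_apply]
    refine card_bij' (fun s hs => ⟨(s, ⟨-∑ i, s i • x i, T.neg_mem (mem_filter.1 hs).2⟩), ?_⟩)
      (fun p _ => p.1.1) ?_ ?_ ?_ ?_
    · rw [LinearMap.mem_ker, hΦ]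
      simp
    · simp
    · rintro ⟨p, hp⟩ _
      rw [LinearMap.mem_ker, hΦ] at hp
      simp only [mem_filter, mem_univ, true_and]
      rw [eq_neg_of_add_eq_zero_left hp]
      exact T.neg_mem p.2.2
    · simp
    · rintro ⟨p, hp⟩ _
      rw [LinearMap.mem_ker, hΦ] at hp
      ext1
      refine Prod.ext rfl (Subtype.ext ?_)
      exact (eq_neg_of_add_eq_zero_right hp).symm
  rw [h3, natCard_eq_pow_finrank (K := F), Nat.card_eq_fintype_card, ← pow_add, ← h2, add_comm]

/-- Double count of pairs `(c, s)` with `s ≠ 0` and `∑ s i • (u + c b) i` in `T`. Counting by `s`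
gives `(q ^ 2 - 1) q`; counting by `c` gives `q - 1` times the left side plus `q ^ 2 - q` times
`shiftsInto`. -/
theorem relShiftCount_of_finrank_eq_one [Fintype F] {T : Submodule F E} (hT : finrank F T = 1)
    {b : Fin 2 → E} (hb : LinearIndependent F b) (u : Fin 2 → E) :
    (relShiftCount F T b u : ℚ) =
      (Fintype.card F : ℚ) ^ 2 + Fintype.card F - Fintype.card F * shiftsInto F T b u := by
  set q := Fintype.card F with hq
  have hq1 : 1 < q := Fintype.one_lt_card
  have hqQ : (1 : ℚ) < q := by exact_mod_cast hq1
  -- Independence makes `∑ s i • b i` nonzero, so the combination runs bijectively through `E` with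
  -- `c`, and it hits `T` exactly `q` times.
  have h1 : ∀ s : Fin 2 → F, s ≠ 0 → #{c : E | ∑ i, s i • (u + c • b) i ∈ T} = q := by
    intro s hs
    have hσ : ∑ i, s i • b i ≠ 0 := fun h =>
      hs (funext fun i => Fintype.linearIndependent_iff.1 hb s h i)
    have hT' : q = #(univ : Finset T) := by
      rw [card_univ, ← Nat.card_eq_fintype_card, card_submodule_eq_pow, hT, pow_one]
    rw [hT']
    have hsum : ∀ c : E, ∑ i, s i • (u + c • b) i = ∑ i, s i • u i + c * ∑ i, s i • b i := by
      intro c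
      simp [smul_add, mul_add]
      ring
    simp only [hsum]
    generalize ∑ i, s i • b i = σ at hσ
    generalize ∑ i, s i • u i = ρ
    refine card_bij' (fun c hc => ⟨_, (mem_filter.1 hc).2⟩) (fun t _ => (t - ρ) / σ) ?_ ?_ ?_ ?_
    · simp
    · intro t _
      simp [div_mul_cancel₀ _ hσ]
    · intro c _
      simp [mul_div_cancel_right₀ _ hσ]
    · intro t _
      ext1
      simp [div_mul_cancel₀ _ hσ]
  -- With `d` the dimension of the joint span, there are `q ^ (3 - d) - 1` nonzero relations for `d
  -- = 1, 2, 3`; this is written through the indicators of `d ≤ 2` and `d = 1`.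
  have h2 : ∀ c : E, (#{s : Fin 2 → F | s ≠ 0 ∧ ∑ i, s i • (u + c • b) i ∈ T} : ℚ) =
      (q - 1) * (if finrank F ↥(Submodule.span F (Set.range (u + c • b)) ⊔ T) ≤ 2 then 1 else 0) +
        (q ^ 2 - q) * (if ∀ i, (u + c • b) i ∈ T then 1 else 0) := by
    intro c
    have h3 := card_relations T (u + c • b)
    have h4 : #{s : Fin 2 → F | ∑ i, s i • (u + c • b) i ∈ T} =
        #{s : Fin 2 → F | s ≠ 0 ∧ ∑ i, s i • (u + c • b) i ∈ T} + 1 := by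
      have : ({s : Fin 2 → F | ∑ i, s i • (u + c • b) i ∈ T} : Finset _) =
          insert 0 ({s : Fin 2 → F | s ≠ 0 ∧ ∑ i, s i • (u + c • b) i ∈ T} : Finset _) := by
        ext s
        simp only [mem_filter, mem_univ, true_and, mem_insert]
        by_cases hs : s = 0
        · simp [hs]
        · simp [hs]
      rw [this, card_insert_of_notMem (by simp)]
    have h5 : (∀ i, (u + c • b) i ∈ T) ↔
        finrank F ↥(Submodule.span F (Set.range (u + c • b)) ⊔ T) = 1 := by
      constructor
      · intro h
        rw [sup_eq_right.2, hT]
        rw [Submodule.span_le]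
        rintro _ ⟨i, rfl⟩
        exact h i
      · intro h i
        have := Submodule.eq_of_le_of_finrank_le
          (le_sup_right : T ≤ Submodule.span F (Set.range (u + c • b)) ⊔ T) (by omega)
        rw [this]
        exact Submodule.mem_sup_left (Submodule.subset_span ⟨i, rfl⟩)
    have h6 : finrank F ↥(Submodule.span F (Set.range (u + c • b)) ⊔ T) ≤ 3 := by
      refine (Submodule.finrank_add_le_finrank_add_finrank _ _).trans ?_
      have := finrank_range_le_card (R := F) (u + c • b)
      rw [Fintype.card_fin] at this
      unfold Set.finrank at this
      omega
    have h7 : 1 ≤ finrank F ↥(Submodule.span F (Set.range (u + c • b)) ⊔ T) := by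
      rw [← hT]
      exact Submodule.finrank_mono le_sup_right
    rw [h4, hT] at h3
    simp only [h5]
    have h3' := congrArg (Nat.cast : ℕ → ℚ) h3
    push_cast at h3'
    rw [← hq] at h3'
    set d := finrank F ↥(Submodule.span F (Set.range (u + c • b)) ⊔ T)
    have hq0 : (q : ℚ) ≠ 0 := by positivity
    generalize #{s : Fin 2 → F | s ≠ 0 ∧ ∑ i, s i • (u + c • b) i ∈ T} = k at h3' ⊢
    interval_cases d
    · have : (k + 1 : ℚ) = q ^ 2 :=
        mul_right_cancel₀ hq0 (by linear_combination h3')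
      norm_num
      linear_combination this
    · have : (k + 1 : ℚ) = q :=
        mul_right_cancel₀ (pow_ne_zero 2 hq0) (by linear_combination h3')
      norm_num
      linear_combination this
    · have : (k + 1 : ℚ) = 1 :=
        mul_right_cancel₀ (pow_ne_zero 3 hq0) (by linear_combination h3')
      norm_num
      have hk : (k : ℚ) = 0 := by linear_combination this
      exact_mod_cast hk
  have h8 := sum_card_bipartiteAbove_eq_sum_card_bipartiteBelow
    (fun (c : E) (s : Fin 2 → F) => ∑ i, s i • (u + c • b) i ∈ T)
    (s := univ) (t := univ.filter fun s => s ≠ 0)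
  simp only [bipartiteAbove, bipartiteBelow, filter_filter] at h8
  have h9 : #{s : Fin 2 → F | s ≠ 0} + 1 = q ^ 2 := by
    rw [filter_ne' univ (0 : Fin 2 → F), card_erase_add_one (mem_univ _), card_univ]
    simp [q]
  rw [sum_congr rfl fun s hs => h1 s (mem_filter.1 hs).2, sum_const, smul_eq_mul] at h8
  have h10 := congrArg (Nat.cast : ℕ → ℚ) h8
  rw [Nat.cast_sum, sum_congr rfl fun c _ => h2 c, sum_add_distrib, ← mul_sum, ← mul_sum,
    sum_boole, sum_boole] at h10
  have h11 := congrArg (Nat.cast : ℕ → ℚ) h9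
  push_cast at h10 h11
  have h12 : (q - 1 : ℚ) * relShiftCount F T b u + (q ^ 2 - q) * shiftsInto F T b u =
    #{s : Fin 2 → F | s ≠ 0} * q := h10
  refine mul_left_cancel₀ (sub_ne_zero.2 hqQ.ne') ?_
  linear_combination h12 + q * h11

/-- `T` is too small to contain a nonzero multiple of `b`, so `shiftsInto` is `0` or `1`. The number
of low-rank shifts is then `q ^ 2 + q` or `q ^ 2`, the latter for `Q q ^ 2` choices of `u`. -/
theorem relShiftSum_of_finrank_eq_one [Fintype F] {T : Submodule F E} (hT : finrank F T = 1)
    {b : Fin 2 → E} (hb : LinearIndependent F b) :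
    relShiftSum F T b =
      ((Fintype.card E : ℚ) ^ 2 - Fintype.card E * (Fintype.card F : ℚ) ^ 2) *
        (((Fintype.card F : ℚ) ^ 2 + Fintype.card F) /
          ((Fintype.card F : ℚ) ^ 2 + Fintype.card F + 1)) +
      Fintype.card E * (Fintype.card F : ℚ) ^ 2 *
        ((Fintype.card F : ℚ) ^ 2 / ((Fintype.card F : ℚ) ^ 2 + 1)) := by
  unfold relShiftSum
  simp only [relShiftCount_of_finrank_eq_one hT hb]
  rw [sum_comp_shiftsInto T b fun e => ((Fintype.card F : ℚ) ^ 2 + Fintype.card F -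
    Fintype.card F * e) / (1 + ((Fintype.card F : ℚ) ^ 2 + Fintype.card F - Fintype.card F * e)),
    shiftsInto_zero_of_finrank_lt hb (by omega), card_submodule_eq_pow, hT]
  simp [add_comm]

/-- If some `c₀ ≠ 0` carries `b` into the span of `t`, the two planes differ by the factor `c₀`, and
division by `c₀` turns scalars into one plane into stabilisers of the other. -/
theorem shiftsInto_span_eq {b t : Fin 2 → E} (hb : LinearIndependent F b)
    (ht : LinearIndependent F t) (h : shiftsInto F (Submodule.span F (Set.range t)) b 0 ≠ 1) :
    shiftsInto F (Submodule.span F (Set.range t)) b 0 =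
      shiftsInto F (Submodule.span F (Set.range b)) b 0 := by
  obtain ⟨c₀, hc₀, h0⟩ : ∃ c₀ : E,
      (∀ i, c₀ * b i ∈ Submodule.span F (Set.range t)) ∧ c₀ ≠ 0 := by
    have := lt_of_le_of_ne (one_le_shiftsInto_zero (Submodule.span F (Set.range t)) b) h.symm
    obtain ⟨c, hc, h0⟩ := exists_mem_ne this 0
    exact ⟨c, by simpa using hc, h0⟩
  have h1 := span_eq_of_linearIndependent (W := Submodule.span F (Set.range t)) (k := 2)
    (by rw [finrank_span_eq_card ht, Fintype.card_fin]) (smul_linearIndependent hb h0) hc₀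
  have h2 : Submodule.span F (Set.range (c₀ • b)) =
      (Submodule.span F (Set.range b)).map (LinearMap.mulLeft F c₀) := by
    rw [Submodule.map_span, ← Set.range_comp]
    rfl
  have h3 : ∀ x, c₀ * x ∈ Submodule.span F (Set.range t) ↔ x ∈ Submodule.span F (Set.range b) := by
    intro x
    rw [← h1, h2]
    constructor
    · rintro ⟨y, hy, hxy⟩
      rwa [← mul_right_injective₀ h0 hxy]
    · exact fun hx => ⟨x, hx, rfl⟩
  refine card_bij' (fun c _ => c / c₀) (fun c _ => c₀ * c) ?_ ?_ ?_ ?_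
  · intro c hc
    simp only [mem_filter, mem_univ, true_and, Pi.add_apply, Pi.smul_apply, Pi.zero_apply,
      zero_add, smul_eq_mul] at hc ⊢
    intro i
    rw [← h3, ← mul_assoc, mul_div_cancel₀ _ h0]
    exact hc i
  · intro c hc
    simp only [mem_filter, mem_univ, true_and, Pi.add_apply, Pi.smul_apply, Pi.zero_apply,
      zero_add, smul_eq_mul] at hc ⊢
    intro i
    rw [mul_assoc, h3]
    exact hc i
  · intro c _
    exact mul_div_cancel₀ _ h0
  · intro c _
    exact mul_div_cancel_left₀ _ h0

/-- Double count over `c ≠ 0`: the entries of `c b` lie in the span of `t` exactly when `t` is an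
ordered basis of the plane they span, and each plane has `|GL_2(F)|` ordered bases. -/
theorem sum_shiftsInto_sub_one [Fintype F] {b : Fin 2 → E} (hb : LinearIndependent F b) :
    ∑ t : Fin 2 → E with LinearIndependent F t,
      ((shiftsInto F (Submodule.span F (Set.range t)) b 0 : ℚ) - 1) =
      (Fintype.card E - 1) *
        (((Fintype.card F : ℚ) ^ 2 - 1) * ((Fintype.card F : ℚ) ^ 2 - Fintype.card F)) := by
  have h1 : ∀ t : Fin 2 → E, (shiftsInto F (Submodule.span F (Set.range t)) b 0 : ℚ) - 1 =
      #{c : E | c ≠ 0 ∧ ∀ i, c * b i ∈ Submodule.span F (Set.range t)} := by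
    intro t
    have : ({c : E | ∀ i, ((0 : Fin 2 → E) + c • b) i ∈ Submodule.span F (Set.range t)} : Finset E) =
        insert 0 ({c : E | c ≠ 0 ∧ ∀ i, c * b i ∈ Submodule.span F (Set.range t)} : Finset E) := by
      ext c
      by_cases hc : c = 0
      · simp [hc]
      · simp [hc]
    rw [shiftsInto, this, card_insert_of_notMem (by simp)]
    simp
  have h2 : ∀ c : E, c ≠ 0 → (#{t : Fin 2 → E | LinearIndependent F t ∧
      ∀ i, c * b i ∈ Submodule.span F (Set.range t)} : ℚ) =
      (((Fintype.card F : ℚ) ^ 2 - 1) * ((Fintype.card F : ℚ) ^ 2 - Fintype.card F)) := by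
    intro c hc
    have hcb := smul_linearIndependent hb hc
    have hW : finrank F (Submodule.span F (Set.range (c • b))) = 2 := by
      rw [finrank_span_eq_card hcb, Fintype.card_fin]
    have h3 := card_filter_span_eq hW
    rw [Fin.prod_univ_two] at h3
    simp only [Fin.val_zero, Fin.val_one, pow_zero, pow_one] at h3
    rw [← h3]
    norm_cast
    refine congrArg Finset.card (filter_congr fun t _ => ?_)
    constructor
    · rintro ⟨ht, h⟩
      exact (span_eq_of_linearIndependent (k := 2)
        (by rw [finrank_span_eq_card ht, Fintype.card_fin]) hcb h).symm
    · intro h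
      exact ⟨linearIndependent_of_span_eq hW h, fun i => h ▸ Submodule.subset_span ⟨i, rfl⟩⟩
  have h8 := sum_card_bipartiteAbove_eq_sum_card_bipartiteBelow
    (fun (t : Fin 2 → E) (c : E) => ∀ i, c * b i ∈ Submodule.span F (Set.range t))
    (s := univ.filter fun t => LinearIndependent F t) (t := univ.filter fun s => s ≠ 0)
  simp only [bipartiteAbove, bipartiteBelow, filter_filter] at h8
  simp only [h1]
  rw [← Nat.cast_sum, h8, Nat.cast_sum, sum_congr rfl fun c hc => h2 c (mem_filter.1 hc).2,
    sum_const, nsmul_eq_mul, filter_ne', card_erase_of_mem (mem_univ _), card_univ,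
    Nat.cast_sub Fintype.card_pos, Nat.cast_one]

/-- The count is always `1` or `m`. On these two values `1 / (1 + x)` agrees with an affine function
of `x - 1`, whose sum `sum_shiftsInto_sub_one` provides. -/
theorem sum_inv_one_add_shiftsInto [Fintype F] {b : Fin 2 → E} (hb : LinearIndependent F b)
    {n m : ℕ} (hn : finrank F E = n) (h2n : 2 ≤ n)
    (hm : shiftsInto F (Submodule.span F (Set.range b)) b 0 = m) (hm1 : 1 < m) :
    ∑ t : Fin 2 → E with LinearIndependent F t,
      1 / (1 + (shiftsInto F (Submodule.span F (Set.range t)) b 0 : ℚ)) =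
      ((Fintype.card F : ℚ) ^ n - 1) * ((Fintype.card F : ℚ) ^ n - Fintype.card F) / 2 -
      (1 / 2 - 1 / (1 + m)) * ((Fintype.card E - 1) *
        (((Fintype.card F : ℚ) ^ 2 - 1) * ((Fintype.card F : ℚ) ^ 2 - Fintype.card F)) / (m - 1)) := by
  have hm0 : (m - 1 : ℚ) ≠ 0 := sub_ne_zero.2 (by exact_mod_cast hm1.ne')
  have h1 : ∀ t ∈ univ.filter (fun t : Fin 2 → E => LinearIndependent F t),
      1 / (1 + (shiftsInto F (Submodule.span F (Set.range t)) b 0 : ℚ)) =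
      1 / 2 - ((shiftsInto F (Submodule.span F (Set.range t)) b 0 : ℚ) - 1) *
        ((1 / 2 - 1 / (1 + m)) / (m - 1)) := by
    intro t ht
    by_cases h : shiftsInto F (Submodule.span F (Set.range t)) b 0 = 1
    · rw [h]; norm_num
    · rw [shiftsInto_span_eq hb (mem_filter.1 ht).2 h, hm]
      field_simp
      ring
  have hc := card_linearIndependent_filter (F := F) (V := E) hn h2n
  rw [Fin.prod_univ_two] at hc
  simp only [Fin.val_zero, Fin.val_one, pow_zero, pow_one] at hc
  rw [sum_congr rfl h1, sum_sub_distrib, ← sum_mul, sum_shiftsInto_sub_one hb, sum_const,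
    nsmul_eq_mul, hc]
  ring

end Shifts

/-! ### Scalars stabilising a plane, and the quadratic subfield -/

section Stabilizer

open Module Finset
open scoped Classical

variable {F E : Type*} [Field F] [Field E] [Algebra F E]

/-- The scalars that map `W` into itself. -/
def scalarStabilizer (W : Submodule F E) : Subalgebra F E where
  carrier := {c | ∀ x ∈ W, c * x ∈ W}
  mul_mem' {a b} ha hb x hx := by
    rw [mul_assoc]
    exact ha _ (hb x hx)
  add_mem' {a b} ha hb x hx := by
    rw [add_mul]
    exact W.add_mem (ha x hx) (hb x hx)
  algebraMap_mem' r x hx := by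
    rw [← Algebra.smul_def]
    exact W.smul_mem r hx

theorem mem_scalarStabilizer_span {r : ℕ} {b : Fin r → E} {c : E} :
    c ∈ scalarStabilizer (Submodule.span F (Set.range b)) ↔
      ∀ i, c * b i ∈ Submodule.span F (Set.range b) := by
  constructor
  · exact fun h i => h _ (Submodule.subset_span ⟨i, rfl⟩)
  · intro h
    have : Submodule.span F (Set.range b) ≤
        (Submodule.span F (Set.range b)).comap (LinearMap.mulLeft F c) := by
      rw [Submodule.span_le]
      rintro _ ⟨i, rfl⟩
      exact h i
    exact fun x hx => this hx

/-- Bounds the order of the stabiliser by that of the plane; equality will mean that `b 1` is a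
stabilising multiple of `b 0`. -/
theorem stabilizer_to_span_injective {b : Fin 2 → E} (hb : LinearIndependent F b) :
    Function.Injective fun c : scalarStabilizer (Submodule.span F (Set.range b)) =>
      (⟨c.1 * b 0, mem_scalarStabilizer_span.1 c.2 0⟩ : Submodule.span F (Set.range b)) := by
  intro c d h
  exact Subtype.ext (mul_left_injective₀ (hb.ne_zero 0) (congrArg Subtype.val h))

theorem linearIndependent_pair_iff_div {b : Fin 2 → E} :
    LinearIndependent F b ↔ b 0 ≠ 0 ∧ b 1 / b 0 ∉ Set.range (algebraMap F E) := by
  constructor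
  · intro h
    refine ⟨h.ne_zero 0, ?_⟩
    rintro ⟨c, hc⟩
    have := Fintype.linearIndependent_iff.1 h ![c, -1]
      (by simp [Fin.sum_univ_two, Algebra.smul_def, hc, div_mul_cancel₀ _ (h.ne_zero 0)]) 1
    simp at this
  · rintro ⟨h0, h⟩
    rw [Fintype.linearIndependent_iff]
    intro s hs
    rw [Fin.sum_univ_two] at hs
    have h1 : s 1 = 0 := by
      by_contra h1
      refine h ⟨-(s 0 / s 1), ?_⟩
      have h1' : algebraMap F E (s 1) ≠ 0 := by simpa using h1
      rw [Algebra.smul_def, Algebra.smul_def] at hs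
      rw [map_neg, map_div₀, eq_div_iff h0]
      field_simp
      linear_combination -hs
    rw [h1, zero_smul, add_zero, smul_eq_zero] at hs
    intro i
    fin_cases i
    · exact hs.resolve_right h0
    · exact h1

/-- The elements of `E` fixed by the square of the Frobenius map over `F`. -/
def quadraticSubalgebra (F E : Type*) [Field F] [Field E] [Algebra F E] [Fintype F] : Subalgebra F E :=
  AlgHom.equalizer (FiniteField.frobeniusAlgHom F E ^ 2) (AlgHom.id F E)

theorem mem_quadraticSubalgebra [Fintype F] {x : E} :
    x ∈ quadraticSubalgebra F E ↔ x ^ Fintype.card F ^ 2 = x := by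
  simp [quadraticSubalgebra, pow_two, pow_mul]

variable [Fintype E]

/-- A finite subring of a field is itself a field. -/
theorem Subalgebra.pow_card_eq_self (S : Subalgebra F E) {x : E} (hx : x ∈ S) :
    x ^ Nat.card S = x := by
  let _ : Field S := (Finite.isField_of_domain S).toField
  have := FiniteField.pow_card (⟨x, hx⟩ : S)
  rw [Nat.card_eq_fintype_card]
  exact congrArg Subtype.val this

theorem shiftsInto_eq_card_scalarStabilizer {r : ℕ} (b : Fin r → E) :
    shiftsInto F (Submodule.span F (Set.range b)) b 0 =
      Nat.card (scalarStabilizer (Submodule.span F (Set.range b))) := by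
  rw [Nat.card_eq_fintype_card, Fintype.card_subtype]
  simp [shiftsInto, mem_scalarStabilizer_span]

variable [Fintype F]

/-- Apart from `0`, the elements are the solutions of `x ^ (q ^ 2 - 1) = 1` in the cyclic group
`Eˣ`, whose order `q ^ 4 - 1` is divisible by `q ^ 2 - 1`. -/
theorem card_quadraticSubalgebra (hE : finrank F E = 4) :
    Nat.card (quadraticSubalgebra F E) = Fintype.card F ^ 2 := by
  set q := Fintype.card F
  have hq : 1 < q := Fintype.one_lt_card
  have hq2 : 1 < q ^ 2 := Nat.one_lt_pow two_ne_zero hq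
  have hker := IsCyclic.card_powMonoidHom_ker (G := Eˣ) (q ^ 2 - 1)
  have hdvd : q ^ 2 - 1 ∣ Nat.card Eˣ := by
    rw [Nat.card_units, Nat.card_eq_fintype_card, card_eq_pow_finrank (K := F), hE]
    exact ⟨q ^ 2 + 1, by rw [mul_comm, ← Nat.sq_sub_sq, ← pow_mul]⟩
  rw [Nat.gcd_eq_right hdvd] at hker
  have h1 : Nat.card (quadraticSubalgebra F E) = #{x : E | x ^ q ^ 2 = x} := by
    rw [Nat.card_eq_fintype_card, Fintype.card_subtype]
    simp only [mem_quadraticSubalgebra]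
    rfl
  have h2 : ({x : E | x ^ q ^ 2 = x} : Finset E) =
      insert 0 ({x : E | x ≠ 0 ∧ x ^ q ^ 2 = x} : Finset E) := by
    ext x
    by_cases hx : x = 0
    · simp [hx]
      omega
    · simp [hx]
  have h3 : #{x : E | x ≠ 0 ∧ x ^ q ^ 2 = x} =
      Nat.card (powMonoidHom (q ^ 2 - 1) : Eˣ →* Eˣ).ker := by
    have hx1 : ∀ x : E, x ≠ 0 → (x ^ q ^ 2 = x ↔ x ^ (q ^ 2 - 1) = 1) := by
      intro x hx
      conv_lhs => rw [← Nat.sub_add_cancel hq2.le, pow_succ]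
      exact mul_eq_right₀ hx
    rw [Nat.card_eq_fintype_card, ← card_univ]
    refine card_bij' (fun x hx => ⟨Units.mk0 x (mem_filter.1 hx).2.1, ?_⟩) (fun u _ => u.1)
      ?_ ?_ ?_ ?_
    · have h := (mem_filter.1 hx).2
      rw [MonoidHom.mem_ker]
      ext
      simpa using (hx1 x h.1).1 h.2
    · simp
    · rintro ⟨u, hu⟩ _
      rw [MonoidHom.mem_ker] at hu
      simp only [mem_filter, mem_univ, true_and]
      refine ⟨u.ne_zero, (hx1 _ u.ne_zero).2 ?_⟩
      simpa using congrArg Units.val hu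
    · simp
    · rintro ⟨u, hu⟩ _
      ext
      rfl
  rw [h1, h2, card_insert_of_notMem (by simp), h3, hker]
  omega

theorem card_span_pair {b : Fin 2 → E} (hb : LinearIndependent F b) :
    Nat.card (Submodule.span F (Set.range b)) = Fintype.card F ^ 2 := by
  rw [card_submodule_eq_pow, finrank_span_eq_card hb, Fintype.card_fin]

theorem card_scalarStabilizer_le {b : Fin 2 → E} (hb : LinearIndependent F b) :
    Nat.card (scalarStabilizer (Submodule.span F (Set.range b))) ≤ Fintype.card F ^ 2 := by
  rw [← card_span_pair hb]
  exact Nat.card_le_card_of_injective _ (stabilizer_to_span_injective hb)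

/-- The stabiliser is a nonzero `F`-space with at most `q ^ 2` elements. -/
theorem card_scalarStabilizer_eq_or {b : Fin 2 → E} (hb : LinearIndependent F b) :
    Nat.card (scalarStabilizer (Submodule.span F (Set.range b))) = Fintype.card F ∨
      Nat.card (scalarStabilizer (Submodule.span F (Set.range b))) = Fintype.card F ^ 2 := by
  have h1 := card_scalarStabilizer_le hb
  have h2 : Nat.card (scalarStabilizer (Submodule.span F (Set.range b))) = Fintype.card F ^
      finrank F (scalarStabilizer (Submodule.span F (Set.range b))) := by
    rw [natCard_eq_pow_finrank (K := F), Nat.card_eq_fintype_card]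
  rw [h2] at h1 ⊢
  have h3 := (Nat.pow_le_pow_iff_right (Fintype.one_lt_card (α := F))).1 h1
  have h4 : 0 < finrank F (scalarStabilizer (Submodule.span F (Set.range b))) := finrank_pos
  interval_cases finrank F (scalarStabilizer (Submodule.span F (Set.range b)))
  · exact Or.inl (pow_one _)
  · exact Or.inr rfl

/-- If the order is `q ^ 2`, then `c ↦ c * b 0` maps onto the plane, so `b 1 / b 0` is a stabiliser
and hence a root of `x ^ (q ^ 2) = x`. Conversely, dividing the plane by `b 0` yields the quadratic
subfield, which is closed under its own multiplication. -/
theorem card_scalarStabilizer_eq_sq_iff (hE : finrank F E = 4) {b : Fin 2 → E}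
    (hb : LinearIndependent F b) :
    Nat.card (scalarStabilizer (Submodule.span F (Set.range b))) = Fintype.card F ^ 2 ↔
      b 1 / b 0 ∈ quadraticSubalgebra F E := by
  have hb0 : b 0 ≠ 0 := hb.ne_zero 0
  constructor
  · intro h
    have hsurj := ((Nat.bijective_iff_injective_and_card _).2
      ⟨stabilizer_to_span_injective hb, h.trans (card_span_pair hb).symm⟩).2
    obtain ⟨⟨c, hc⟩, hcb⟩ := hsurj ⟨b 1, Submodule.subset_span ⟨1, rfl⟩⟩
    have hcb' : c * b 0 = b 1 := congrArg Subtype.val hcb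
    rw [← hcb', mul_div_cancel_right₀ _ hb0, mem_quadraticSubalgebra, ← h]
    exact Subalgebra.pow_card_eq_self _ hc
  · intro h
    refine le_antisymm (card_scalarStabilizer_le hb) ?_
    rw [← card_quadraticSubalgebra hE]
    refine Nat.card_mono (Set.toFinite _) ?_
    have hspan : Submodule.span F (Set.range ((b 0)⁻¹ • b)) =
        Subalgebra.toSubmodule (quadraticSubalgebra F E) := by
      refine span_eq_of_linearIndependent (k := 2) ?_
        (smul_linearIndependent hb (inv_ne_zero hb0)) ?_
      · refine Nat.pow_right_injective (Fintype.one_lt_card (α := F)) ?_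
        change Fintype.card F ^ _ = _
        rw [← card_submodule_eq_pow]
        exact card_quadraticSubalgebra hE
      · intro i
        fin_cases i
        · simp [hb0, (quadraticSubalgebra F E).one_mem]
        · simpa [div_eq_inv_mul] using h
    intro c hc
    refine mem_scalarStabilizer_span.2 fun i => ?_
    have h1 : ∀ x ∈ quadraticSubalgebra F E, b 0 * x ∈ Submodule.span F (Set.range b) := by
      intro x hx
      rw [← Subalgebra.mem_toSubmodule, ← hspan] at hx
      obtain ⟨s, rfl⟩ := (Submodule.mem_span_range_iff_exists_fun F).1 hx
      rw [mul_sum]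
      refine Submodule.sum_mem _ fun j _ => ?_
      rw [mul_smul_comm, Pi.smul_apply, smul_eq_mul, mul_inv_cancel_left₀ hb0]
      exact Submodule.smul_mem _ _ (Submodule.subset_span ⟨j, rfl⟩)
    have h2 : b i / b 0 ∈ quadraticSubalgebra F E := by
      fin_cases i
      · simp [hb0, (quadraticSubalgebra F E).one_mem]
      · exact h
    have h3 := h1 _ ((quadraticSubalgebra F E).mul_mem hc h2)
    rwa [mul_left_comm, mul_div_cancel₀ _ hb0] at h3

/-- Such a `b` amounts to a nonzero `b 0` and a ratio `b 1 / b 0` in the quadratic subfield but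
outside `F`. -/
theorem card_linearIndependent_quadratic (hE : finrank F E = 4) :
    (#{b : Fin 2 → E | LinearIndependent F b ∧
      Nat.card (scalarStabilizer (Submodule.span F (Set.range b))) = Fintype.card F ^ 2} : ℚ) =
      ((Fintype.card E : ℚ) - 1) * ((Fintype.card F : ℚ) ^ 2 - Fintype.card F) := by
  have h1 : #{b : Fin 2 → E | LinearIndependent F b ∧
      Nat.card (scalarStabilizer (Submodule.span F (Set.range b))) = Fintype.card F ^ 2} =
      #((univ.filter fun x : E => x ≠ 0) ×ˢ ((univ.filter fun x => x ∈ quadraticSubalgebra F E) \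
        univ.image (algebraMap F E))) := by
    refine card_bij' (fun b _ => (b 0, b 1 / b 0)) (fun p _ => ![p.1, p.2 * p.1]) ?_ ?_ ?_ ?_
    · intro b hb
      obtain ⟨h, h'⟩ := (mem_filter.1 hb).2
      rw [card_scalarStabilizer_eq_sq_iff hE h] at h'
      rw [linearIndependent_pair_iff_div] at h
      simpa [h'] using h
    · rintro ⟨x, y⟩ h
      simp only [mem_product, mem_filter, mem_univ, true_and, mem_sdiff, mem_image] at h
      obtain ⟨hx, hy, hy'⟩ := h
      have hli : LinearIndependent F ![x, y * x] :=
        linearIndependent_pair_iff_div.2 (by simpa [hx] using hy')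
      rw [mem_filter, card_scalarStabilizer_eq_sq_iff hE hli]
      exact ⟨mem_univ _, hli, by simpa [hx] using hy⟩
    · intro b hb
      have h := (linearIndependent_pair_iff_div.1 (mem_filter.1 hb).2.1).1
      ext i
      fin_cases i
      · simp
      · simp [h]
    · rintro ⟨x, y⟩ h
      simp only [mem_product, mem_filter, mem_univ, true_and] at h
      simp [h.1]
  have h2 : (univ.image (algebraMap F E)) ⊆ univ.filter fun x => x ∈ quadraticSubalgebra F E := by
    intro x hx
    obtain ⟨c, _, rfl⟩ := mem_image.1 hx
    simp [(quadraticSubalgebra F E).algebraMap_mem c]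
  have h3 : #(univ.filter fun x => x ∈ quadraticSubalgebra F E) = Fintype.card F ^ 2 := by
    rw [← card_quadraticSubalgebra hE, Nat.card_eq_fintype_card, Fintype.card_subtype]
  have h4 : #(univ.image (algebraMap F E)) = Fintype.card F := by
    rw [card_image_of_injective _ (algebraMap F E).injective, card_univ]
  rw [h1, card_product, card_sdiff_of_subset h2, h3, h4, filter_ne', card_erase_of_mem (mem_univ _),
    card_univ, Nat.cast_mul, Nat.cast_sub Fintype.card_pos,
    Nat.cast_sub (Nat.le_self_pow two_ne_zero _)]
  push_cast
  rfl

end Stabilizer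

/-! ### Closed forms of the sums in ranks one and two -/

section Totals

open Module Finset
open scoped Classical

variable {F E : Type*} [Field F] [Field E] [Algebra F E] [Fintype E]

theorem sum_eq_sum_range_vectorRank {k : ℕ} (f : (Fin k → E) → ℚ) :
    ∑ t, f t = ∑ r ∈ range (k + 1), ∑ t : Fin k → E with vectorRank F E t = r, f t := by
  refine (sum_fiberwise_of_maps_to (fun t _ => ?_) _).symm
  have := finrank_range_le_card (R := F) t
  rw [Fintype.card_fin] at this
  exact mem_range.2 (Nat.lt_succ_of_le this)

theorem shiftsInto_zero_of_single {T : Submodule F E} {b : Fin 1 → E}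
    (hb : LinearIndependent F b) : shiftsInto F T b 0 = Nat.card T := by
  have hb0 : b 0 ≠ 0 := hb.ne_zero 0
  rw [Nat.card_eq_fintype_card, ← card_univ]
  refine card_bij' (fun c hc => ⟨_, (mem_filter.1 hc).2 0⟩) (fun t _ => t / b 0) ?_ ?_ ?_ ?_
  · simp
  · simp [hb0]
  · simp [hb0]
  · simp [hb0]

theorem card_vectorRank_eq_zero {m : ℕ} :
    (#{v : Fin m → E | vectorRank F E v = 0} : ℚ) = 1 := by
  rw [Nat.cast_eq_one, card_eq_one]
  refine ⟨0, ?_⟩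
  ext v
  simp [vectorRank, Submodule.finrank_eq_zero, Submodule.span_eq_bot, funext_iff]

variable [Fintype F]

theorem cast_card_eq (hE : finrank F E = 4) : (Fintype.card E : ℚ) = (Fintype.card F : ℚ) ^ 4 := by
  rw [card_eq_pow_finrank (K := F), hE, Nat.cast_pow]

theorem card_vectorRank_eq_one (hE : finrank F E = 4) {m : ℕ} (hm : 1 ≤ m) :
    (#{v : Fin m → E | vectorRank F E v = 1} : ℚ) =
      ((Fintype.card F : ℚ) ^ m - 1) * ((Fintype.card F : ℚ) ^ 4 - 1) / (Fintype.card F - 1) := by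
  have h := card_vectorRank_eq (F := F) (E := E) hE hm (by norm_num)
  have hq : (1 : ℚ) < Fintype.card F := by exact_mod_cast Fintype.one_lt_card
  simp only [Fin.prod_univ_one, Fin.val_zero, pow_zero, pow_one] at h
  rw [eq_div_iff (sub_ne_zero.2 hq.ne'), h]

theorem card_vectorRank_eq_two (hE : finrank F E = 4) {m : ℕ} (hm : 2 ≤ m) :
    (#{v : Fin m → E | vectorRank F E v = 2} : ℚ) =
      (((Fintype.card F : ℚ) ^ m - 1) * ((Fintype.card F : ℚ) ^ m - Fintype.card F)) *
      (((Fintype.card F : ℚ) ^ 4 - 1) * ((Fintype.card F : ℚ) ^ 4 - Fintype.card F)) /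
        (((Fintype.card F : ℚ) ^ 2 - 1) * ((Fintype.card F : ℚ) ^ 2 - Fintype.card F)) := by
  have h := card_vectorRank_eq (F := F) (E := E) hE hm (by norm_num)
  have hq : (1 : ℚ) < Fintype.card F := by exact_mod_cast Fintype.one_lt_card
  simp only [Fin.prod_univ_two, Fin.val_zero, Fin.val_one, pow_zero, pow_one] at h
  rw [eq_div_iff, h]
  refine mul_ne_zero (sub_ne_zero.2 ?_) (sub_ne_zero.2 ?_)
  · exact (one_lt_pow₀ hq two_ne_zero).ne'
  · exact (lt_self_pow₀ hq one_lt_two).ne'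

/-- The three summands belong to `t` of rank `0`, `1`, `2`; rank `3` contributes nothing. In rank
`2`, `m = |T| = q ^ 2` because `b` is a single nonzero entry. -/
theorem shiftSum_append_one (hE : finrank F E = 4) {b : Fin 1 → E} (hb : LinearIndependent F b)
    {q : ℚ} (hq : q = Fintype.card F) :
    shiftSum F (Fin.append b (0 : Fin 3 → E)) =
      q ^ 4 * (q ^ 4 / (1 + q ^ 4)) +
      (q ^ 3 - 1) * (q ^ 4 - 1) / (q - 1) * (q ^ 4 * (q ^ 4 / (1 + q ^ 4))) +
      ((q ^ 3 - 1) * (q ^ 3 - q)) * ((q ^ 4 - 1) * (q ^ 4 - q)) / ((q ^ 2 - 1) * (q ^ 2 - q)) *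
        (q ^ 4 * q ^ 2 / (1 + q ^ 2)) := by
  have h0 : ∀ t ∈ univ.filter (fun t : Fin 3 → E => vectorRank F E t = 0),
      relShiftSum F (Submodule.span F (Set.range t)) b = q ^ 4 * (q ^ 4 / (1 + q ^ 4)) := by
    intro t ht
    have ht' : finrank F (Submodule.span F (Set.range t)) = 0 := (mem_filter.1 ht).2
    rw [relShiftSum_of_add_le b (by omega), cast_card_eq hE, hq, pow_one]
  have h1 : ∀ t ∈ univ.filter (fun t : Fin 3 → E => vectorRank F E t = 1),
      relShiftSum F (Submodule.span F (Set.range t)) b = q ^ 4 * (q ^ 4 / (1 + q ^ 4)) := by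
    intro t ht
    have ht' : finrank F (Submodule.span F (Set.range t)) = 1 := (mem_filter.1 ht).2
    rw [relShiftSum_of_add_le b (by omega), cast_card_eq hE, hq, pow_one]
  have h2 : ∀ t ∈ univ.filter (fun t : Fin 3 → E => vectorRank F E t = 2),
      relShiftSum F (Submodule.span F (Set.range t)) b = q ^ 4 * q ^ 2 / (1 + q ^ 2) := by
    intro t ht
    have ht' : finrank F (Submodule.span F (Set.range t)) = 2 := (mem_filter.1 ht).2
    rw [relShiftSum_of_finrank_eq_two b ht', shiftsInto_zero_of_single hb, card_submodule_eq_pow,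
      ht', cast_card_eq hE, hq, pow_one, Nat.cast_pow]
  have h3 : ∀ t ∈ univ.filter (fun t : Fin 3 → E => vectorRank F E t = 3),
      relShiftSum F (Submodule.span F (Set.range t)) b = 0 := by
    intro t ht
    have ht' : finrank F (Submodule.span F (Set.range t)) = 3 := (mem_filter.1 ht).2
    exact relShiftSum_of_three_le b ht'.ge
  rw [shiftSum_append, sum_eq_sum_range_vectorRank (F := F)]
  simp only [sum_range_succ, sum_range_zero, zero_add]
  rw [sum_congr rfl h0, sum_congr rfl h1, sum_congr rfl h2, sum_congr rfl h3]
  simp only [sum_const, nsmul_eq_mul, card_vectorRank_eq_zero,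
    card_vectorRank_eq_one hE (m := 3) (by norm_num),
    card_vectorRank_eq_two hE (m := 3) (by norm_num), ← hq]
  ring

/-- The summands again belong to `t` of rank `0`, `1`, `2`. Only the last depends on `b`, and only
through the order `m` of the stabiliser of its plane. -/
theorem shiftSum_append_two (hE : finrank F E = 4) {b : Fin 2 → E} (hb : LinearIndependent F b)
    {m : ℕ} (hm : Nat.card (scalarStabilizer (Submodule.span F (Set.range b))) = m) (hm1 : 1 < m)
    {q : ℚ} (hq : q = Fintype.card F) :
    shiftSum F (Fin.append b (0 : Fin 2 → E)) =
      q ^ 8 * (q ^ 4 / (1 + q ^ 4)) +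
      (q ^ 2 - 1) * (q ^ 4 - 1) / (q - 1) *
        ((q ^ 8 - q ^ 6) * ((q ^ 2 + q) / (q ^ 2 + q + 1)) + q ^ 6 * (q ^ 2 / (q ^ 2 + 1))) +
      q ^ 8 * ((q ^ 4 - 1) * (q ^ 4 - q) / 2 -
        (1 / 2 - 1 / (1 + m)) * ((q ^ 4 - 1) * ((q ^ 2 - 1) * (q ^ 2 - q)) / (m - 1))) := by
  have h0 : ∀ t ∈ univ.filter (fun t : Fin 2 → E => vectorRank F E t = 0),
      relShiftSum F (Submodule.span F (Set.range t)) b = q ^ 8 * (q ^ 4 / (1 + q ^ 4)) := by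
    intro t ht
    have ht' : finrank F (Submodule.span F (Set.range t)) = 0 := (mem_filter.1 ht).2
    rw [relShiftSum_of_add_le b (by omega), cast_card_eq hE, hq, ← pow_mul]
  have h1 : ∀ t ∈ univ.filter (fun t : Fin 2 → E => vectorRank F E t = 1),
      relShiftSum F (Submodule.span F (Set.range t)) b =
        (q ^ 8 - q ^ 6) * ((q ^ 2 + q) / (q ^ 2 + q + 1)) + q ^ 6 * (q ^ 2 / (q ^ 2 + 1)) := by
    intro t ht
    rw [relShiftSum_of_finrank_eq_one (mem_filter.1 ht).2 hb, cast_card_eq hE, ← hq]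
    ring
  have h2 : ∀ t ∈ univ.filter (fun t : Fin 2 → E => vectorRank F E t = 2),
      relShiftSum F (Submodule.span F (Set.range t)) b =
        q ^ 8 * (1 / (1 + (shiftsInto F (Submodule.span F (Set.range t)) b 0 : ℚ))) := by
    intro t ht
    have ht' : finrank F (Submodule.span F (Set.range t)) = 2 := (mem_filter.1 ht).2
    rw [relShiftSum_of_finrank_eq_two b ht', card_submodule_eq_pow,
      ht', cast_card_eq hE, hq, Nat.cast_pow]
    ring
  rw [shiftSum_append, sum_eq_sum_range_vectorRank (F := F)]
  simp only [sum_range_succ, sum_range_zero, zero_add]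
  rw [sum_congr rfl h0, sum_congr rfl h1, sum_congr rfl h2]
  simp only [vectorRank_eq_iff_linearIndependent]
  rw [← mul_sum (univ.filter fun t : Fin 2 → E => LinearIndependent F t), sum_inv_one_add_shiftsInto hb hE (by norm_num)
    ((shiftsInto_eq_card_scalarStabilizer b).trans hm) hm1]
  simp only [sum_const, nsmul_eq_mul, card_vectorRank_eq_zero,
    card_vectorRank_eq_one hE (m := 2) (by norm_num), cast_card_eq hE, ← hq]
  ring

theorem sum_shiftSum_vectorRank_one (hE : finrank F E = 4) {q : ℚ} (hq : q = Fintype.card F) :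
    ∑ v : Fin 4 → E with vectorRank F E v = 1, shiftSum F v =
      (q ^ 4 - 1) ^ 2 / (q - 1) *
      (q ^ 4 * (q ^ 4 / (1 + q ^ 4)) +
      (q ^ 3 - 1) * (q ^ 4 - 1) / (q - 1) * (q ^ 4 * (q ^ 4 / (1 + q ^ 4))) +
      ((q ^ 3 - 1) * (q ^ 3 - q)) * ((q ^ 4 - 1) * (q ^ 4 - q)) / ((q ^ 2 - 1) * (q ^ 2 - q)) *
        (q ^ 4 * q ^ 2 / (1 + q ^ 2))) := by
  have h := sum_vectorRank_eq (F := F) (r := 1) (m := 4) (E := E) fun v => shiftSum F v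
  have hq1 : 1 < q := by rw [hq]; exact_mod_cast Fintype.one_lt_card
  have h1 : ∀ M ∈ univ.filter (fun M : Matrix (Fin 1) (Fin 4) F => LinearIndependent F fun i => M i),
      ∀ b ∈ univ.filter (fun b : Fin 1 → E => LinearIndependent F b),
      shiftSum F (scalarVecMul b M) = _ := fun M hM b hb =>
    (shiftSum_scalarVecMul_append (k := 3) b (mem_filter.1 hM).2).trans
      (shiftSum_append_one hE (mem_filter.1 hb).2 hq)
  have hM : (#{M : Matrix (Fin 1) (Fin 4) F | LinearIndependent F fun i => M i} : ℚ) = _ :=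
    card_linearIndependent_filter (F := F) (V := Fin 4 → F) (k := 1) (n := 4) (by simp)
      (by norm_num)
  rw [sum_congr rfl fun M hM => sum_congr rfl (h1 M hM)] at h
  simp only [sum_const, nsmul_eq_mul] at h
  rw [hM, card_linearIndependent_filter hE (by norm_num)] at h
  simp only [Fin.prod_univ_one, Fin.val_zero, pow_zero, pow_one, ← hq] at h
  rw [div_mul_eq_mul_div, eq_div_iff (sub_ne_zero.2 hq1.ne'), h]
  ring

/-- `g x` is the inner sum for a stabiliser of order `x`. Of the `(q ^ 4 - 1) (q ^ 4 - q)`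
independent pairs, `(q ^ 4 - 1) (q ^ 2 - q)` have order `q ^ 2`, and the others have order `q`. -/
theorem sum_shiftSum_vectorRank_two (hE : finrank F E = 4) {q : ℚ} (hq : q = Fintype.card F)
    {g : ℚ → ℚ} (hg : ∀ x, g x = q ^ 8 * (q ^ 4 / (1 + q ^ 4)) +
      (q ^ 2 - 1) * (q ^ 4 - 1) / (q - 1) *
        ((q ^ 8 - q ^ 6) * ((q ^ 2 + q) / (q ^ 2 + q + 1)) + q ^ 6 * (q ^ 2 / (q ^ 2 + 1))) +
      q ^ 8 * ((q ^ 4 - 1) * (q ^ 4 - q) / 2 -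
        (1 / 2 - 1 / (1 + x)) * ((q ^ 4 - 1) * ((q ^ 2 - 1) * (q ^ 2 - q)) / (x - 1)))) :
    ∑ v : Fin 4 → E with vectorRank F E v = 2, shiftSum F v =
      (q ^ 4 - 1) * (q ^ 4 - q) / ((q ^ 2 - 1) * (q ^ 2 - q)) *
      ((q ^ 4 - 1) * (q ^ 2 - q) * g (q ^ 2) + (q ^ 4 - 1) * (q ^ 4 - q ^ 2) * g q) := by
  have h := sum_vectorRank_eq (F := F) (r := 2) (m := 4) (E := E) fun v => shiftSum F v
  have hF1 : 1 < Fintype.card F := Fintype.one_lt_card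
  have hq1 : 1 < q := by rw [hq]; exact_mod_cast hF1
  have h1 : ∀ b ∈ univ.filter (fun b : Fin 2 → E => LinearIndependent F b),
      shiftSum F (Fin.append b (0 : Fin 2 → E)) = g q + (g (q ^ 2) - g q) *
        if Nat.card (scalarStabilizer (Submodule.span F (Set.range b))) = Fintype.card F ^ 2
        then 1 else 0 := by
    intro b hb
    have hb' := (mem_filter.1 hb).2
    by_cases hc : Nat.card (scalarStabilizer (Submodule.span F (Set.range b))) = Fintype.card F ^ 2
    · rw [if_pos hc, shiftSum_append_two hE hb' hc (Nat.one_lt_pow two_ne_zero hF1) hq,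
        Nat.cast_pow, ← hq, ← hg]
      ring
    · rw [if_neg hc, shiftSum_append_two hE hb' ((card_scalarStabilizer_eq_or hb').resolve_right hc)
        hF1 hq, ← hq, ← hg]
      ring
  have h2 : ∀ M ∈ univ.filter (fun M : Matrix (Fin 2) (Fin 4) F => LinearIndependent F fun i => M i),
      ∑ b : Fin 2 → E with LinearIndependent F b, shiftSum F (scalarVecMul b M) =
        ∑ b : Fin 2 → E with LinearIndependent F b, shiftSum F (Fin.append b (0 : Fin 2 → E)) :=
    fun M hM => sum_congr rfl fun b _ =>
      shiftSum_scalarVecMul_append (k := 2) b (mem_filter.1 hM).2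
  have hM : (#{M : Matrix (Fin 2) (Fin 4) F | LinearIndependent F fun i => M i} : ℚ) = _ :=
    card_linearIndependent_filter (F := F) (V := Fin 4 → F) (k := 2) (n := 4) (by simp)
      (by norm_num)
  rw [sum_congr rfl h2, sum_const, nsmul_eq_mul, hM, sum_congr rfl h1, sum_add_distrib, ← mul_sum,
    sum_boole, filter_filter, card_linearIndependent_quadratic hE, sum_const, nsmul_eq_mul,
    card_linearIndependent_filter hE (by norm_num), cast_card_eq hE] at h
  simp only [Fin.prod_univ_two, Fin.val_zero, Fin.val_one, pow_zero, pow_one, ← hq] at h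
  rw [div_mul_eq_mul_div, eq_div_iff, h]
  · ring
  refine mul_ne_zero (sub_ne_zero.2 ?_) (sub_ne_zero.2 ?_)
  · exact (one_lt_pow₀ hq1 two_ne_zero).ne'
  · exact (lt_self_pow₀ hq1 one_lt_two).ne'

theorem card_vectorRank_mem (hE : finrank F E = 4) {q : ℚ} (hq : q = Fintype.card F) :
    (#{v : Fin 4 → E | vectorRank F E v = 1 ∨ vectorRank F E v = 2} : ℚ) =
      (q ^ 4 - 1) * (q ^ 8 + q ^ 7 + 2 * q ^ 6 - q ^ 3 + 1) := by
  have hq1 : 1 < q := by rw [hq]; exact_mod_cast Fintype.one_lt_card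
  have h1 : q - 1 ≠ 0 := sub_ne_zero.2 hq1.ne'
  have h2 : q ≠ 0 := by positivity
  have h3 : q + 1 ≠ 0 := by positivity
  rw [filter_or, card_union_of_disjoint, Nat.cast_add, card_vectorRank_eq_one hE (by norm_num),
    card_vectorRank_eq_two hE (by norm_num), ← hq,
    show (q ^ 2 - 1) * (q ^ 2 - q) = q * (q - 1) ^ 2 * (q + 1) by ring]
  · field_simp
    ring
  · rw [disjoint_filter]
    omega

/-- The subtracted term is the contribution of `w` in `E v`. The denominators of the separate cases
cancel only in the total. -/
theorem sum_shiftSum (hE : finrank F E = 4) {q : ℚ} (hq : q = Fintype.card F) :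
    ∑ v : Fin 4 → E with vectorRank F E v = 1 ∨ vectorRank F E v = 2,
      (shiftSum F v - q ^ 4 * (q ^ 4 / (1 + q ^ 4))) =
      (q ^ 4 - 1) ^ 2 * q ^ 4 * (1 / 2 * (q ^ 16 + 3 * q ^ 14 + q ^ 13 + 3 * q ^ 12 + q ^ 11 +
        q ^ 10 - q ^ 9 + q ^ 7 + 4 * q ^ 6 - 2 * q ^ 3)) := by
  have hq1 : 1 < q := by rw [hq]; exact_mod_cast Fintype.one_lt_card
  have h1 : q - 1 ≠ 0 := sub_ne_zero.2 hq1.ne'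
  have h2 : q ≠ 0 := by positivity
  have h3 : q + 1 ≠ 0 := by positivity
  have h4 : q ^ 2 + 1 ≠ 0 := by positivity
  have h5 : q ^ 4 + 1 ≠ 0 := by positivity
  have h6 : q ^ 2 + q + 1 ≠ 0 := by positivity
  rw [sum_sub_distrib, sum_const, nsmul_eq_mul, card_vectorRank_mem hE hq, filter_or, sum_union,
    sum_shiftSum_vectorRank_one hE hq, sum_shiftSum_vectorRank_two hE hq fun _ => rfl,
    show (q ^ 2 - 1) * (q ^ 2 - q) = q * (q - 1) ^ 2 * (q + 1) by ring,
    show q ^ 2 - 1 = (q - 1) * (q + 1) by ring, add_comm 1 (q ^ 4), add_comm 1 (q ^ 2),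
    add_comm 1 q]
  · field_simp
    ring
  · rw [disjoint_filter]
    omega

end Totals

/-! ### The Möbius function in ranks one and two -/

namespace RankMetricLattice

open Module Finset
open scoped Classical

section LowRank

variable {F E : Type*} [Field F] [Field E] [Algebra F E] {i n : ℕ}

theorem smul_mem_lowRankVectors {v : Fin n → E} (hv : v ∈ lowRankVectors F E i n) (c : E) :
    c • v ∈ lowRankVectors F E i n := by
  have h : Submodule.span F (Set.range (c • v)) =
      (Submodule.span F (Set.range v)).map (LinearMap.mulLeft F c) := by
    rw [Submodule.map_span, ← Set.range_comp]
    rfl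
  change vectorRank F E (c • v) ≤ i
  refine le_trans ?_ (show vectorRank F E v ≤ i from hv)
  unfold vectorRank
  rw [h]
  have : FiniteDimensional F (Submodule.span F (Set.range v)) :=
    FiniteDimensional.span_of_finite F (Set.finite_range v)
  exact Submodule.finrank_map_le _ _

theorem smul_mem_lowRankVectors_iff {v : Fin n → E} {c : E} (hc : c ≠ 0) :
    c • v ∈ lowRankVectors F E i n ↔ v ∈ lowRankVectors F E i n := by
  refine ⟨fun h => ?_, fun h => smul_mem_lowRankVectors h c⟩
  have := smul_mem_lowRankVectors h c⁻¹
  rwa [inv_smul_smul₀ hc] at this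

theorem mem_lowRankVectors_of_mem_span_pair {v : Fin n → E} {a b : E}
    (h : ∀ j, v j ∈ Submodule.span F {a, b}) : v ∈ lowRankVectors F E 2 n := by
  have h1 : Submodule.span F (Set.range v) ≤ Submodule.span F {a, b} := by
    rw [Submodule.span_le]
    rintro _ ⟨j, rfl⟩
    exact h j
  have h2 : finrank F (Submodule.span F ({a, b} : Set E)) ≤ 2 := by
    have := finrank_span_finset_le_card (R := F) ({a, b} : Finset E)
    rw [coe_insert, coe_singleton] at this
    exact this.trans card_le_two
  have : FiniteDimensional F (Submodule.span F ({a, b} : Set E)) :=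
    FiniteDimensional.span_of_finite F (Set.toFinite _)
  exact (Submodule.finrank_mono h1).trans h2

theorem finrank_span_pair {v w : Fin n → E} (hv : v ≠ 0) (hw : w ∉ Submodule.span E {v}) :
    finrank E (Submodule.span E {v, w}) = 2 := by
  have h : LinearIndependent E ![v, w] := by
    rw [LinearIndependent.pair_iff' hv]
    exact fun a ha => hw (Submodule.mem_span_singleton.2 ⟨a, ha⟩)
  have := finrank_span_eq_card h
  rwa [Matrix.range_cons_cons_empty, Fintype.card_fin] at this

/-- A functional has a nonzero zero on the plane of the first two coordinates, and a vector with at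
most two nonzero entries is low-rank. -/
theorem exists_lowRank_mem_ker (a : Dual E (Fin (n + 2) → E)) :
    ∃ x : Fin (n + 2) → E, x ≠ 0 ∧ x ∈ lowRankVectors F E 2 (n + 2) ∧ a x = 0 := by
  have key : ∀ r s : E, r • Pi.single (0 : Fin (n + 2)) (1 : E) + s • Pi.single 1 1 ∈
      lowRankVectors F E 2 (n + 2) := by
    intro r s
    refine mem_lowRankVectors_of_mem_span_pair (a := r) (b := s) fun k => ?_
    have hr : r ∈ Submodule.span F {r, s} := Submodule.subset_span (Set.mem_insert _ _)
    have hs : s ∈ Submodule.span F {r, s} :=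
      Submodule.subset_span (Set.mem_insert_of_mem _ rfl)
    by_cases h0 : k = 0
    · subst h0
      simpa using hr
    · by_cases h1 : k = 1
      · subst h1
        simpa using hs
      · simp [h0, h1]
  by_cases h : a (Pi.single 0 1) = 0
  · refine ⟨_, ?_, key 1 0, ?_⟩
    · intro h0
      simpa using congrFun h0 0
    · simp [h]
  -- With `e₀`, `e₁` the first two unit vectors, `a` kills `a(e₁) e₀ - a(e₀) e₁`.
  · refine ⟨_, ?_, key (a (Pi.single 1 1)) (-a (Pi.single 0 1)), ?_⟩
    · intro h0
      exact h (by simpa using congrFun h0 1)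
    · rw [map_add, map_smul, map_smul, smul_eq_mul, smul_eq_mul]
      ring

end LowRank

section Invariants

variable {F E : Type*} [Field F] [Field E] [Algebra F E] [Fintype E] {i n : ℕ}

theorem mem_ofSet_of_mem {S : Set (Fin n → E)} (hS : S ⊆ lowRankVectors F E i n) {x : Fin n → E}
    (hx : x ∈ S) : x ∈ (ofSet S hS).carrier :=
  Submodule.subset_span hx

theorem grade_eq_zero_iff {s : RankMetricLattice F E i n} : grade ℕ s = 0 ↔ s = ⊥ := by
  rw [grade_eq_finrank, Submodule.finrank_eq_zero, ← coe_bot (F := F) (i := i)]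
  exact ⟨fun h => RankMetricLattice.ext h, fun h => h ▸ rfl⟩

theorem exists_carrier_eq_span_singleton {s : RankMetricLattice F E i n} (hs : grade ℕ s = 1) :
    ∃ v, v ≠ 0 ∧ v ∈ lowRankVectors F E i n ∧ s.carrier = Submodule.span E {v} := by
  obtain ⟨v, hv, hv0⟩ : ∃ v, (v ∈ s.carrier ∧ v ∈ lowRankVectors F E i n) ∧ v ≠ 0 := by
    by_contra! hcon
    have h : s.carrier = ⊥ := by
      rw [eq_span s, Submodule.span_eq_bot]
      exact hcon
    rw [grade_eq_finrank, h, finrank_bot] at hs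
    omega
  refine ⟨v, hv0, hv.2, (Submodule.eq_of_le_of_finrank_eq ?_ ?_).symm⟩
  · rw [Submodule.span_singleton_le_iff_mem]
    exact hv.1
  · rw [finrank_span_singleton hv0, ← grade_eq_finrank, hs]

/-- The number of nonzero vectors of rank at most `i` in `U`. -/
noncomputable def lowRankCount (U : RankMetricLattice F E i n) : ℕ :=
  #{v : Fin n → E | v ≠ 0 ∧ v ∈ U.carrier ∧ v ∈ lowRankVectors F E i n}

theorem card_span_singleton_sdiff_zero {v : Fin n → E} (hv : v ≠ 0) :
    #{x : Fin n → E | x ≠ 0 ∧ x ∈ Submodule.span E {v}} = Fintype.card E - 1 := by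
  rw [← card_univ, ← card_erase_of_mem (mem_univ (0 : E))]
  symm
  refine card_bij (fun c _ => c • v) ?_ ?_ ?_
  · intro c hc
    simp only [mem_filter, mem_univ, true_and]
    exact ⟨smul_ne_zero (ne_of_mem_erase hc) hv,
      Submodule.smul_mem _ _ (Submodule.mem_span_singleton_self v)⟩
  · intro c _ d _ h
    exact smul_left_injective E hv h
  · intro x hx
    obtain ⟨h0, h⟩ := (mem_filter.1 hx).2
    obtain ⟨c, rfl⟩ := Submodule.mem_span_singleton.1 h
    refine ⟨c, mem_erase.2 ⟨?_, mem_univ _⟩, rfl⟩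
    rintro rfl
    exact h0 (zero_smul _ _)

/-- An atom is `E v` with `v` low-rank, so all its `Q - 1` nonzero vectors are low-rank; and each
nonzero low-rank vector of `U` lies in exactly one atom. -/
theorem card_atoms_le_mul (U : RankMetricLattice F E i n) :
    #{s : RankMetricLattice F E i n | grade ℕ s = 1 ∧ s ≤ U} * (Fintype.card E - 1) =
      lowRankCount U := by
  have h := sum_card_bipartiteAbove_eq_sum_card_bipartiteBelow
    (fun (s : RankMetricLattice F E i n) (v : Fin n → E) => v ∈ s.carrier)
    (s := univ.filter fun s => grade ℕ s = 1 ∧ s ≤ U)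
    (t := univ.filter fun v => v ≠ 0 ∧ v ∈ U.carrier ∧ v ∈ lowRankVectors F E i n)
  have hA : ∀ s ∈ univ.filter (fun s : RankMetricLattice F E i n => grade ℕ s = 1 ∧ s ≤ U),
      #(bipartiteAbove (fun s v => v ∈ s.carrier)
        (univ.filter fun v => v ≠ 0 ∧ v ∈ U.carrier ∧ v ∈ lowRankVectors F E i n) s) =
        Fintype.card E - 1 := by
    intro s hs
    obtain ⟨hs1, hsU⟩ := (mem_filter.1 hs).2
    obtain ⟨v, hv0, hvl, hv⟩ := exists_carrier_eq_span_singleton hs1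
    rw [← card_span_singleton_sdiff_zero hv0, bipartiteAbove, filter_filter]
    refine congrArg Finset.card (filter_congr fun x _ => ?_)
    rw [hv]
    constructor
    · exact fun h => ⟨h.1.1, h.2⟩
    · rintro ⟨hx0, hx⟩
      refine ⟨⟨hx0, hsU (hv ▸ hx), ?_⟩, hx⟩
      obtain ⟨c, rfl⟩ := Submodule.mem_span_singleton.1 hx
      exact smul_mem_lowRankVectors hvl c
  have hB : ∀ v ∈ univ.filter (fun v : Fin n → E =>
      v ≠ 0 ∧ v ∈ U.carrier ∧ v ∈ lowRankVectors F E i n),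
      #(bipartiteBelow (fun (s : RankMetricLattice F E i n) v => v ∈ s.carrier)
        (univ.filter fun s => grade ℕ s = 1 ∧ s ≤ U) v) = 1 := by
    intro v hv
    obtain ⟨h0, hU, hl⟩ := (mem_filter.1 hv).2
    rw [bipartiteBelow, card_eq_one]
    refine ⟨ofSet {v} (Set.singleton_subset_iff.2 hl), ?_⟩
    ext s
    simp only [mem_filter, mem_univ, true_and, mem_singleton]
    constructor
    · rintro ⟨⟨hs, -⟩, hvs⟩
      refine RankMetricLattice.ext (Submodule.eq_of_le_of_finrank_eq ?_ ?_).symm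
      · exact Submodule.span_le.2 (Set.singleton_subset_iff.2 hvs)
      · exact (finrank_span_singleton h0).trans hs.symm
    · rintro rfl
      exact ⟨⟨finrank_span_singleton h0, Submodule.span_le.2 (Set.singleton_subset_iff.2 hU)⟩,
        mem_ofSet_of_mem _ rfl⟩
  rw [sum_congr rfl hA, sum_congr rfl hB, sum_const, sum_const, smul_eq_mul, smul_eq_mul,
    mul_one] at h
  exact h

theorem mu_of_grade_eq_one {s : RankMetricLattice F E i n} (hs : grade ℕ s = 1) :
    IncidenceAlgebra.mu ℤ ⊥ s = -1 := by
  have h0 : ⊥ ≠ s := by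
    rintro rfl
    rw [grade_eq_zero_iff.2 rfl] at hs
    omega
  have h : Ico ⊥ s = {⊥} := by
    ext t
    simp only [mem_Ico, bot_le, true_and, mem_singleton]
    constructor
    · intro ht
      have := grade_strictMono (𝕆 := ℕ) ht
      exact grade_eq_zero_iff.1 (by omega)
    · rintro rfl
      exact bot_lt_iff_ne_bot.2 h0.symm
  rw [IncidenceAlgebra.mu_eq_neg_sum_Ico_of_ne h0, h, sum_singleton, IncidenceAlgebra.mu_self]

/-- Strictly below `U` there are only the bottom, with value `1`, and the atoms, with value `-1`. -/
theorem mu_of_grade_eq_two {U : RankMetricLattice F E i n} (hU : grade ℕ U = 2) :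
    IncidenceAlgebra.mu ℤ ⊥ U =
      #{s : RankMetricLattice F E i n | grade ℕ s = 1 ∧ s ≤ U} - 1 := by
  have h0 : ⊥ ≠ U := by
    rintro rfl
    rw [grade_eq_zero_iff.2 rfl] at hU
    omega
  have h : Ico ⊥ U =
      insert ⊥ (univ.filter fun s : RankMetricLattice F E i n => grade ℕ s = 1 ∧ s ≤ U) := by
    ext t
    simp only [mem_Ico, bot_le, true_and, mem_insert, mem_filter, mem_univ]
    constructor
    · intro ht
      have := grade_strictMono (𝕆 := ℕ) ht
      by_cases h1 : grade ℕ t = 0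
      · exact Or.inl (grade_eq_zero_iff.1 h1)
      · exact Or.inr ⟨by omega, ht.le⟩
    · rintro (rfl | ⟨h1, h2⟩)
      · exact bot_lt_iff_ne_bot.2 h0.symm
      · refine lt_of_le_of_ne h2 ?_
        rintro rfl
        omega
  rw [IncidenceAlgebra.mu_eq_neg_sum_Ico_of_ne h0, h, sum_insert, IncidenceAlgebra.mu_self,
    sum_congr rfl fun s hs => mu_of_grade_eq_one (mem_filter.1 hs).2.1, sum_const]
  · simp
    ring
  · simp [grade_eq_zero_iff.2 (rfl : (⊥ : RankMetricLattice F E i n) = ⊥)]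

theorem whitneyFirst_zero : whitneyFirst (RankMetricLattice F E i n) 0 = 1 := by
  unfold whitneyFirst
  rw [sum_congr (s₂ := {⊥}) (g := fun s => IncidenceAlgebra.mu ℤ ⊥ s) _ fun _ _ => rfl]
  · rw [sum_singleton, IncidenceAlgebra.mu_self]
  · ext s
    rw [mem_filter, mem_singleton]
    exact (and_iff_right (mem_univ s)).trans grade_eq_zero_iff

theorem whitneyFirst_one_mul :
    (whitneyFirst (RankMetricLattice F E i n) 1 : ℚ) * (Fintype.card E - 1) =
      -(lowRankCount (⊤ : RankMetricLattice F E i n) : ℚ) := by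
  unfold whitneyFirst
  rw [← card_atoms_le_mul, sum_congr rfl fun s hs => mu_of_grade_eq_one (mem_filter.1 hs).2]
  simp [Nat.cast_sub (Fintype.card_pos (α := E))]

theorem carrier_eq_span_pair {U : RankMetricLattice F E i n} (hU : grade ℕ U = 2)
    {v w : Fin n → E} (hv : v ≠ 0) (hw : w ∉ Submodule.span E {v}) (hvU : v ∈ U.carrier)
    (hwU : w ∈ U.carrier) : U.carrier = Submodule.span E {v, w} := by
  refine (Submodule.eq_of_le_of_finrank_eq (Submodule.span_le.2 ?_) ?_).symm
  · rintro _ (rfl | rfl)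
    · exact hvU
    · exact hwU
  · rw [finrank_span_pair hv hw, ← grade_eq_finrank, hU]

/-- The one-dimensional subspaces of `⟨v, w⟩` are `E v` and the `E (w + c v)`, one for each `c`;
each low-rank one has `Q - 1` nonzero vectors. -/
theorem lowRankCount_of_grade_eq_two {U : RankMetricLattice F E 2 n} (hU : grade ℕ U = 2)
    {v w : Fin n → E} (hv : v ≠ 0) (hvl : v ∈ lowRankVectors F E 2 n)
    (hw : w ∉ Submodule.span E {v}) (hvU : v ∈ U.carrier) (hwU : w ∈ U.carrier) :
    lowRankCount U = (Fintype.card E - 1) * (1 + shiftCount F v w) := by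
  have hsp := carrier_eq_span_pair hU hv hw hvU hwU
  have h1 : #{x : Fin n → E | (x ≠ 0 ∧ x ∈ U.carrier ∧ x ∈ lowRankVectors F E 2 n) ∧
      x ∈ Submodule.span E {v}} = Fintype.card E - 1 := by
    rw [← card_span_singleton_sdiff_zero hv]
    refine congrArg Finset.card (filter_congr fun x _ => ?_)
    constructor
    · exact fun h => ⟨h.1.1, h.2⟩
    · rintro ⟨hx0, hx⟩
      refine ⟨⟨hx0, ?_⟩, hx⟩
      obtain ⟨c, rfl⟩ := Submodule.mem_span_singleton.1 hx
      exact ⟨U.carrier.smul_mem c hvU, smul_mem_lowRankVectors hvl c⟩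
  have h2 : #{x : Fin n → E | (x ≠ 0 ∧ x ∈ U.carrier ∧ x ∈ lowRankVectors F E 2 n) ∧
      x ∉ Submodule.span E {v}} = (Fintype.card E - 1) * shiftCount F v w := by
    rw [← card_univ, ← card_erase_of_mem (mem_univ (0 : E)), shiftCount, ← card_product]
    have hmem : ∀ b c : E, b ≠ 0 → b • (w + c • v) ∉ Submodule.span E {v} := by
      intro b c hb h
      have h' := (Submodule.smul_mem_iff _ hb).1 h
      exact hw ((Submodule.add_mem_iff_left _
        (Submodule.smul_mem _ _ (Submodule.mem_span_singleton_self v))).1 h')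
    symm
    refine card_bij (fun p _ => p.1 • (w + p.2 • v)) ?_ ?_ ?_
    · rintro ⟨b, c⟩ h
      simp only [mem_product, mem_erase, mem_univ, and_true, mem_filter, true_and] at h ⊢
      have hm := hmem b c h.1
      refine ⟨⟨?_, ?_, ?_⟩, hm⟩
      · intro h0
        rw [h0] at hm
        exact hm (Submodule.zero_mem _)
      · exact U.carrier.smul_mem _ (U.carrier.add_mem hwU (U.carrier.smul_mem _ hvU))
      · exact smul_mem_lowRankVectors h.2 b
    · rintro ⟨b, c⟩ h ⟨b', c'⟩ h' heq
      simp only [mem_product, mem_erase, mem_univ, and_true, mem_filter, true_and] at h h' heq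
      have hbb : b = b' := by
        by_contra hne
        refine hw ((Submodule.smul_mem_iff _ (sub_ne_zero.2 hne)).1
          (Submodule.mem_span_singleton.2 ⟨b' * c' - b * c, ?_⟩))
        rw [smul_add, smul_add, smul_smul, smul_smul] at heq
        rw [sub_smul, sub_smul, sub_eq_sub_iff_add_eq_add, add_comm, ← heq, add_comm]
      subst hbb
      have h3 := smul_left_injective E hv (add_left_cancel (smul_right_injective _ h.1 heq))
      exact Prod.ext rfl h3
    · intro x hx
      obtain ⟨⟨hx0, hxU, hxl⟩, hxv⟩ := (mem_filter.1 hx).2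
      rw [hsp, Submodule.mem_span_pair] at hxU
      obtain ⟨a, b, rfl⟩ := hxU
      have hb : b ≠ 0 := by
        rintro rfl
        rw [zero_smul, add_zero] at hxv
        exact hxv (Submodule.smul_mem _ _ (Submodule.mem_span_singleton_self v))
      have hx' : b • (w + (a / b) • v) = a • v + b • w := by
        rw [smul_add, smul_smul, mul_div_cancel₀ _ hb, add_comm]
      refine ⟨(b, a / b), ?_, hx'⟩
      simp only [mem_product, mem_erase, mem_univ, and_true, mem_filter, true_and]
      refine ⟨hb, ?_⟩
      rw [← hx'] at hxl
      exact (smul_mem_lowRankVectors_iff hb).1 hxl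
  unfold lowRankCount
  rw [← card_filter_add_card_filter_not (fun x => x ∈ Submodule.span E {v}), filter_filter,
    filter_filter, h1, h2]
  ring

end Invariants

end RankMetricLattice

/-! ### Whitney numbers as sums over vectors, and the root `Q` -/

namespace RankMetricLattice

open Module Finset
open scoped Classical

section Invariants

variable {F E : Type*} [Field F] [Field E] [Algebra F E] [Fintype E] {i n : ℕ}

theorem natCard_submodule_eq_pow (W : Submodule E (Fin n → E)) :
    Nat.card W = Fintype.card E ^ finrank E W := by
  rw [natCard_eq_pow_finrank (K := E), Nat.card_eq_fintype_card]

theorem card_mem_submodule (W : Submodule E (Fin n → E)) :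
    #{w : Fin n → E | w ∈ W} = Fintype.card E ^ finrank E W := by
  rw [← natCard_submodule_eq_pow, Nat.card_eq_fintype_card, Fintype.card_subtype]

/-- Every pair has weight `(N - 1) / N`. There are `N (Q - 1)` choices of `v` and `Q ^ 2 - Q` of
`w`, so `N` cancels and the value `N - 1` of `μ` remains. -/
theorem sum_shiftCount_ratio_of_grade_eq_two {U : RankMetricLattice F E 2 n}
    (hU : grade ℕ U = 2) :
    ∑ v : Fin n → E with v ≠ 0 ∧ v ∈ U.carrier ∧ v ∈ lowRankVectors F E 2 n,
      ∑ w : Fin n → E with w ∈ U.carrier ∧ w ∉ Submodule.span E {v},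
        (shiftCount F v w : ℚ) / (1 + shiftCount F v w) =
      ((Fintype.card E : ℚ) - 1) ^ 2 * Fintype.card E *
        (IncidenceAlgebra.mu ℤ (⊥ : RankMetricLattice F E 2 n) U : ℤ) := by
  have hQ : 1 < Fintype.card E := Fintype.one_lt_card
  have hQ' : (1 : ℚ) < Fintype.card E := by exact_mod_cast hQ
  have hQ0 : (Fintype.card E : ℚ) - 1 ≠ 0 := sub_ne_zero.2 hQ'.ne'
  have hatoms := card_atoms_le_mul U
  rw [mu_of_grade_eq_two hU]
  set N := #{s : RankMetricLattice F E 2 n | grade ℕ s = 1 ∧ s ≤ U} with hN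
  have hcount : (lowRankCount U : ℚ) = N * (Fintype.card E - 1) := by
    rw [← hatoms, Nat.cast_mul, Nat.cast_sub hQ.le, Nat.cast_one]
  have hw : ∀ v ∈ univ.filter (fun v : Fin n → E =>
      v ≠ 0 ∧ v ∈ U.carrier ∧ v ∈ lowRankVectors F E 2 n),
      ∑ w : Fin n → E with w ∈ U.carrier ∧ w ∉ Submodule.span E {v},
        (shiftCount F v w : ℚ) / (1 + shiftCount F v w) =
      ((Fintype.card E : ℚ) ^ 2 - Fintype.card E) * ((N - 1) / N) := by
    intro v hv
    obtain ⟨hv0, hvU, hvl⟩ := (mem_filter.1 hv).2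
    have h1 : ∀ w ∈ univ.filter (fun w : Fin n → E => w ∈ U.carrier ∧ w ∉ Submodule.span E {v}),
        (shiftCount F v w : ℚ) / (1 + shiftCount F v w) = (N - 1) / N := by
      intro w hw
      obtain ⟨hwU, hwv⟩ := (mem_filter.1 hw).2
      have h := lowRankCount_of_grade_eq_two hU hv0 hvl hwv hvU hwU
      rw [← hatoms, mul_comm] at h
      have h2 := Nat.eq_of_mul_eq_mul_left (by omega) h
      rw [h2]
      push_cast
      rw [add_sub_cancel_left]
    have h2 : (#{w : Fin n → E | w ∈ U.carrier ∧ w ∉ Submodule.span E {v}} : ℚ) =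
        (Fintype.card E : ℚ) ^ 2 - Fintype.card E := by
      have h3 := card_filter_add_card_filter_not (s := univ.filter fun w => w ∈ U.carrier)
        (fun w => w ∈ Submodule.span E {v})
      rw [filter_filter, filter_filter, card_mem_submodule, ← grade_eq_finrank, hU] at h3
      have h4 : #{w : Fin n → E | w ∈ U.carrier ∧ w ∈ Submodule.span E {v}} = Fintype.card E := by
        have h5 := card_mem_submodule (Submodule.span E {v})
        rw [finrank_span_singleton hv0, pow_one] at h5
        rw [← h5]
        refine congrArg Finset.card (filter_congr fun w _ => and_iff_right_of_imp fun h => ?_)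
        exact (Submodule.span_singleton_le_iff_mem v U.carrier).2 hvU h
      rw [h4] at h3
      rw [eq_sub_iff_add_eq, add_comm]
      exact_mod_cast h3
    rw [sum_congr rfl h1, sum_const, nsmul_eq_mul, h2]
  rw [sum_congr rfl hw, sum_const, nsmul_eq_mul]
  change (lowRankCount U : ℚ) * _ = _
  rw [hcount]
  -- `U` is nonzero and spanned by its low-rank vectors, so it contains an atom.
  have hN0 : (N : ℚ) ≠ 0 := by
    rw [Nat.cast_ne_zero]
    intro hN0
    rw [hN0, zero_mul] at hatoms
    have h1 : ∀ v ∈ {x | x ∈ U.carrier ∧ x ∈ lowRankVectors F E 2 n}, v = 0 := by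
      rintro v ⟨hvU, hvl⟩
      by_contra hv0
      exact filter_eq_empty_iff.1 (card_eq_zero.1 hatoms.symm) (mem_univ v) ⟨hv0, hvU, hvl⟩
    have h2 : U.carrier = ⊥ := by
      rw [eq_span U, Submodule.span_eq_bot]
      exact h1
    rw [grade_eq_finrank, h2, finrank_bot] at hU
    omega
  field_simp
  push_cast
  ring

/-- For `w` in `E v`, all `Q` shifts are multiples of `v` and hence low-rank. -/
theorem sum_not_mem_span_eq (v : Fin n → E) (hv : v ≠ 0) (hvl : v ∈ lowRankVectors F E 2 n) :
    ∑ w : Fin n → E with w ∉ Submodule.span E {v},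
      (shiftCount F v w : ℚ) / (1 + shiftCount F v w) =
    shiftSum F v - Fintype.card E * (Fintype.card E / (1 + Fintype.card E)) := by
  have h1 : ∀ w ∈ univ.filter (fun w : Fin n → E => w ∈ Submodule.span E {v}),
      (shiftCount F v w : ℚ) / (1 + shiftCount F v w) =
        Fintype.card E / (1 + Fintype.card E) := by
    intro w hw
    obtain ⟨a, rfl⟩ := Submodule.mem_span_singleton.1 (mem_filter.1 hw).2
    have : shiftCount F v (a • v) = Fintype.card E := by
      unfold shiftCount
      rw [filter_true_of_mem, card_univ]
      intro c _
      rw [← add_smul]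
      exact smul_mem_lowRankVectors hvl _
    rw [this]
  have h2 := card_mem_submodule (Submodule.span E {v})
  rw [finrank_span_singleton hv, pow_one] at h2
  unfold shiftSum
  rw [← sum_filter_add_sum_filter_not univ (fun w => w ∈ Submodule.span E {v}), sum_congr rfl h1,
    sum_const, nsmul_eq_mul, h2, add_sub_cancel_left]

/-- A low-rank shift `w + c v` shows that `⟨v, w⟩ = ⟨v, w + c v⟩` belongs to the lattice, and no
other two-dimensional space contains both vectors. -/
theorem card_grade_two_of_shiftCount_ne_zero {v w : Fin n → E} (hv : v ≠ 0)
    (hvl : v ∈ lowRankVectors F E 2 n) (hw : w ∉ Submodule.span E {v})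
    (h : shiftCount F v w ≠ 0) :
    #{U : RankMetricLattice F E 2 n | grade ℕ U = 2 ∧ v ∈ U.carrier ∧ w ∈ U.carrier} = 1 := by
  obtain ⟨c, hc⟩ := card_pos.1 (Nat.pos_of_ne_zero h)
  have hcl : w + c • v ∈ lowRankVectors F E 2 n := (mem_filter.1 hc).2
  have hS : ({v, w + c • v} : Set (Fin n → E)) ⊆ lowRankVectors F E 2 n := by
    rintro _ (rfl | rfl)
    · exact hvl
    · exact hcl
  have hwc : w + c • v ∉ Submodule.span E {v} := fun h' =>
    hw ((Submodule.add_mem_iff_left _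
      (Submodule.smul_mem _ _ (Submodule.mem_span_singleton_self v))).1 h')
  have hvm : v ∈ (ofSet _ hS).carrier := mem_ofSet_of_mem _ (Set.mem_insert _ _)
  have hwm : w ∈ (ofSet _ hS).carrier := by
    have h1 : w + c • v ∈ (ofSet _ hS).carrier :=
      mem_ofSet_of_mem _ (Set.mem_insert_of_mem _ rfl)
    exact (Submodule.add_mem_iff_left _ (Submodule.smul_mem _ _ hvm)).1 h1
  rw [card_eq_one]
  refine ⟨ofSet _ hS, ?_⟩
  ext U
  simp only [mem_filter, mem_univ, true_and, mem_singleton]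
  have hg : grade ℕ (ofSet _ hS) = 2 := finrank_span_pair hv hwc
  constructor
  · rintro ⟨hU, hvU, hwU⟩
    refine RankMetricLattice.ext ?_
    rw [carrier_eq_span_pair hU hv hw hvU hwU, carrier_eq_span_pair hg hv hw hvm hwm]
  · rintro rfl
    exact ⟨hg, hvm, hwm⟩

theorem whitneyFirst_two_mul :
    ((Fintype.card E : ℚ) - 1) ^ 2 * Fintype.card E *
      whitneyFirst (RankMetricLattice F E 2 n) 2 =
    ∑ v : Fin n → E with v ≠ 0 ∧ v ∈ lowRankVectors F E 2 n,
      (shiftSum F v - Fintype.card E * (Fintype.card E / (1 + Fintype.card E))) := by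
  unfold whitneyFirst
  rw [Int.cast_sum, mul_sum]
  have h1 : ∀ U ∈ univ.filter (fun U : RankMetricLattice F E 2 n => grade ℕ U = 2),
      ((Fintype.card E : ℚ) - 1) ^ 2 * Fintype.card E *
        (IncidenceAlgebra.mu ℤ (⊥ : RankMetricLattice F E 2 n) U : ℤ) =
      ∑ v : Fin n → E with v ≠ 0 ∧ v ∈ lowRankVectors F E 2 n,
        ∑ w : Fin n → E with w ∉ Submodule.span E {v},
          if v ∈ U.carrier ∧ w ∈ U.carrier then
            (shiftCount F v w : ℚ) / (1 + shiftCount F v w) else 0 := by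
    intro U hU
    rw [← sum_shiftCount_ratio_of_grade_eq_two (mem_filter.1 hU).2]
    refine sum_subset_zero_on_sdiff ?_ ?_ ?_
    · intro v hv
      obtain ⟨h0, -, hl⟩ := (mem_filter.1 hv).2
      exact mem_filter.2 ⟨mem_univ _, h0, hl⟩
    · intro v hv
      rw [mem_sdiff, mem_filter, mem_filter] at hv
      have : v ∉ U.carrier := fun h => hv.2 ⟨mem_univ _, hv.1.2.1, h, hv.1.2.2⟩
      simp [this]
    · intro v hv
      obtain ⟨h0, hvU, hl⟩ := (mem_filter.1 hv).2
      rw [← sum_filter, filter_filter]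
      refine sum_congr (filter_congr fun w _ => ?_) fun _ _ => rfl
      exact ⟨fun h => ⟨h.2, hvU, h.1⟩, fun h => ⟨h.2.2, h.1⟩⟩
  rw [sum_congr rfl h1, sum_comm]
  refine sum_congr rfl fun v hv => ?_
  obtain ⟨h0, hl⟩ := (mem_filter.1 hv).2
  rw [← sum_not_mem_span_eq v h0 hl, sum_comm]
  refine sum_congr rfl fun w hw => ?_
  rw [← sum_filter, filter_filter, sum_const, nsmul_eq_mul]
  -- Without a low-rank shift the weight is `0`, however many `U` contain the pair.
  by_cases hc : shiftCount F v w = 0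
  · simp [hc]
  · rw [card_grade_two_of_shiftCount_ne_zero h0 hl (mem_filter.1 hw).2 hc, Nat.cast_one, one_mul]

theorem carrier_top : (⊤ : RankMetricLattice F E 2 n).carrier = ⊤ := by
  rw [eq_top_iff, ← (Pi.basisFun E (Fin n)).span_eq, Submodule.span_le]
  rintro _ ⟨j, rfl⟩
  refine Submodule.subset_span (mem_lowRankVectors_of_mem_span_pair (a := 0) (b := 1) fun k => ?_)
  rw [Pi.basisFun_apply, Pi.single_apply]
  split_ifs
  · exact Submodule.subset_span (Set.mem_insert_of_mem _ rfl)
  · exact Submodule.zero_mem _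

theorem grade_top : grade ℕ (⊤ : RankMetricLattice F E 2 n) = n := by
  rw [grade_eq_finrank, carrier_top, finrank_top, finrank_fin_fun]

theorem grade_le (s : RankMetricLattice F E i n) : grade ℕ s ≤ n := by
  rw [grade_eq_finrank]
  exact (Submodule.finrank_le _).trans (finrank_fin_fun E).le

theorem sum_mu_le (K : RankMetricLattice F E i n) :
    ∑ s : RankMetricLattice F E i n with s ≤ K, IncidenceAlgebra.mu ℤ ⊥ s =
      if ⊥ = K then 1 else 0 := by
  rw [← IncidenceAlgebra.sum_Icc_mu_right]
  refine sum_congr ?_ fun _ _ => rfl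
  ext s
  simp

theorem sum_mu_eq_sum_whitneyFirst (f : ℕ → ℚ) :
    ∑ s : RankMetricLattice F E i n, (IncidenceAlgebra.mu ℤ ⊥ s : ℚ) * f (grade ℕ s) =
      ∑ j ∈ range (n + 1), (whitneyFirst (RankMetricLattice F E i n) j : ℚ) * f j := by
  rw [← sum_fiberwise_of_maps_to (g := fun s : RankMetricLattice F E i n => grade ℕ s)
    (t := range (n + 1)) fun s _ => mem_range.2 (Nat.lt_succ_of_le (grade_le s))]
  refine sum_congr rfl fun j _ => ?_
  unfold whitneyFirst
  rw [Int.cast_sum, sum_mul]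
  refine sum_congr rfl fun s hs => ?_
  rw [(mem_filter.1 hs).2]

/-- The power of `Q` counts functionals vanishing on `s`. For a fixed functional `a`, the `s` inside
its kernel are those below the span `K` of the low-rank vectors of the kernel, and the sum of `μ`
below `K` is `0` because `K` is nonzero. -/
theorem sum_mu_mul_pow :
    ∑ s : RankMetricLattice F E 2 (n + 2), (IncidenceAlgebra.mu ℤ ⊥ s : ℚ) *
      (Fintype.card E : ℚ) ^ (n + 2 - grade ℕ s) = 0 := by
  have : Finite (Dual E (Fin (n + 2) → E)) := Module.finite_of_finite E
  have := Fintype.ofFinite (Dual E (Fin (n + 2) → E))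
  have h1 : ∀ s : RankMetricLattice F E 2 (n + 2),
      #{a : Dual E (Fin (n + 2) → E) | s.carrier ≤ LinearMap.ker a} =
        Fintype.card E ^ (n + 2 - grade ℕ s) := by
    intro s
    have h2 := Subspace.finrank_add_finrank_dualAnnihilator_eq s.carrier
    rw [finrank_fin_fun, ← grade_eq_finrank] at h2
    have h3 : finrank E s.carrier.dualAnnihilator = n + 2 - grade ℕ s := by omega
    have h4 := natCard_eq_pow_finrank (K := E) (V := s.carrier.dualAnnihilator)
    rw [h3, Nat.card_eq_fintype_card, Nat.card_eq_fintype_card, Fintype.card_subtype] at h4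
    rw [← h4]
    refine congrArg Finset.card (filter_congr fun a _ => ?_)
    rw [Submodule.mem_dualAnnihilator]
    rfl
  have h2 : ∀ a : Dual E (Fin (n + 2) → E),
      ∑ s : RankMetricLattice F E 2 (n + 2) with s.carrier ≤ LinearMap.ker a,
        IncidenceAlgebra.mu ℤ ⊥ s = 0 := by
    intro a
    let K : RankMetricLattice F E 2 (n + 2) :=
      ofSet {x | x ∈ LinearMap.ker a ∧ x ∈ lowRankVectors F E 2 (n + 2)} fun _ h => h.2
    have hK : ∀ s : RankMetricLattice F E 2 (n + 2), s.carrier ≤ LinearMap.ker a ↔ s ≤ K := by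
      intro s
      constructor
      · intro h
        exact (eq_span s).le.trans (Submodule.span_mono fun x hx => ⟨h hx.1, hx.2⟩)
      · intro h
        exact (le_iff.1 h).trans (Submodule.span_le.2 fun x hx => hx.1)
    simp only [hK]
    rw [sum_mu_le, if_neg]
    intro hbot
    obtain ⟨x, hx0, hxl, hxa⟩ := exists_lowRank_mem_ker (F := F) a
    have hx : x ∈ K.carrier := mem_ofSet_of_mem _ ⟨hxa, hxl⟩
    rw [← hbot, coe_bot, Submodule.mem_bot] at hx
    exact hx0 hx
  have h3 : ∀ s : RankMetricLattice F E 2 (n + 2), (IncidenceAlgebra.mu ℤ ⊥ s : ℚ) *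
      (Fintype.card E : ℚ) ^ (n + 2 - grade ℕ s) =
      ∑ a : Dual E (Fin (n + 2) → E), if s.carrier ≤ LinearMap.ker a then
        (IncidenceAlgebra.mu ℤ ⊥ s : ℚ) else 0 := by
    intro s
    rw [← sum_filter, sum_const, h1, nsmul_eq_mul, Nat.cast_pow, mul_comm]
  rw [sum_congr rfl fun s _ => h3 s, sum_comm]
  refine sum_eq_zero fun a _ => ?_
  rw [← sum_filter]
  exact_mod_cast h2 a

theorem charPolynomial_eq :
    (charPolynomial (RankMetricLattice F E 2 n)).map (Int.castRingHom ℚ) =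
      ∑ j ∈ range (n + 1), Polynomial.C (whitneyFirst (RankMetricLattice F E 2 n) j : ℚ) *
        Polynomial.X ^ (n - j) := by
  unfold charPolynomial
  rw [← sum_fiberwise_of_maps_to (g := fun s : RankMetricLattice F E 2 n => grade ℕ s)
    (t := range (n + 1)) fun s _ => mem_range.2 (Nat.lt_succ_of_le (grade_le s)),
    Polynomial.map_sum]
  refine sum_congr rfl fun j _ => ?_
  unfold whitneyFirst
  rw [Int.cast_sum, map_sum, sum_mul, Polynomial.map_sum]
  refine sum_congr rfl fun s hs => ?_
  rw [(mem_filter.1 hs).2, grade_top]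
  simp

end Invariants

end RankMetricLattice

/-! ### Low-rank vectors by exact rank, and the root `1` -/

namespace RankMetricLattice

open Module Finset
open scoped Classical

section Invariants

variable {F E : Type*} [Field F] [Field E] [Algebra F E] [Fintype E] {n : ℕ}

theorem ne_zero_and_mem_lowRankVectors_two_iff {v : Fin n → E} :
    v ≠ 0 ∧ v ∈ lowRankVectors F E 2 n ↔ vectorRank F E v = 1 ∨ vectorRank F E v = 2 := by
  have h : v = 0 ↔ vectorRank F E v = 0 := by
    simp [vectorRank, Submodule.finrank_eq_zero, Submodule.span_eq_bot, funext_iff]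
  rw [Ne, h]
  change _ ∧ vectorRank F E v ≤ 2 ↔ _
  omega

theorem lowRankCount_top :
    lowRankCount (⊤ : RankMetricLattice F E 2 n) =
      #{v : Fin n → E | vectorRank F E v = 1 ∨ vectorRank F E v = 2} := by
  refine congrArg Finset.card (filter_congr fun v _ => ?_)
  rw [← ne_zero_and_mem_lowRankVectors_two_iff, carrier_top]
  simp

theorem sum_mu_eq_zero :
    ∑ s : RankMetricLattice F E 2 (n + 1), (IncidenceAlgebra.mu ℤ ⊥ s : ℚ) * 1 = 0 := by
  have h := sum_mu_le (⊤ : RankMetricLattice F E 2 (n + 1))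
  rw [if_neg, filter_true_of_mem fun s _ => le_top] at h
  · simp only [mul_one]
    exact_mod_cast h
  · intro hbot
    have h1 := grade_top (F := F) (E := E) (n := n + 1)
    rw [← hbot, grade_eq_zero_iff.2 rfl] at h1
    omega

end Invariants

end RankMetricLattice

/-! ### The Whitney numbers and the characteristic polynomial -/

theorem mainTheorem6
    (hpoly : ∃ P : Polynomial ℚ, ∀ (F : Type u) (E : Type v) [Field F] [Finite F] [Field E]
      [Finite E] [Algebra F E], Module.finrank F E = 4 →
        (whitneyFirst (RankMetricLattice F E 2 4) 2 : ℚ) = P.eval (Nat.card F : ℚ))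
    (F : Type u) (E : Type v) [Field F] [Finite F] [Field E] [Finite E] [Algebra F E]
    (hE : Module.finrank F E = 4) (q : ℚ) (hq : q = (Nat.card F : ℚ)) :
    (whitneyFirst (RankMetricLattice F E 2 4) 0 : ℚ) = 1 ∧
    (whitneyFirst (RankMetricLattice F E 2 4) 1 : ℚ) = -(q ^ 8 + q ^ 7 + 2 * q ^ 6 - q ^ 3 + 1) ∧
    (whitneyFirst (RankMetricLattice F E 2 4) 2 : ℚ) =
      1 / 2 * (q ^ 16 + 3 * q ^ 14 + q ^ 13 + 3 * q ^ 12 + q ^ 11 + q ^ 10 - q ^ 9 + q ^ 7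
        + 4 * q ^ 6 - 2 * q ^ 3) ∧
    (whitneyFirst (RankMetricLattice F E 2 4) 3 : ℚ) =
      -(1 / 2) * (q ^ 20 + 3 * q ^ 18 + q ^ 17 + 2 * q ^ 16 - q ^ 15 + 3 * q ^ 12 + 2 * q ^ 11
        + q ^ 10 - q ^ 9 - 2 * q ^ 8 - q ^ 7) ∧
    (whitneyFirst (RankMetricLattice F E 2 4) 4 : ℚ) =
      1 / 2 * (q ^ 20 + 3 * q ^ 18 + q ^ 17 + q ^ 16 - q ^ 15 - 3 * q ^ 14 - q ^ 13 + q ^ 11) ∧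
    (charPolynomial (RankMetricLattice F E 2 4)).map (Int.castRingHom ℚ) =
      (Polynomial.X - 1) * (Polynomial.X - Polynomial.C (q ^ 4)) *
        (Polynomial.X ^ 2
          - Polynomial.C (q ^ 8 + q ^ 7 + 2 * q ^ 6 - q ^ 4 - q ^ 3) * Polynomial.X
          + Polynomial.C (1 / 2 * (q ^ 16 + 3 * q ^ 14 + q ^ 13 + q ^ 12 - q ^ 11 - 3 * q ^ 10
            - q ^ 9 + q ^ 7))) := by
  have := Fintype.ofFinite F
  have := Fintype.ofFinite E
  rw [Nat.card_eq_fintype_card] at hq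
  have hq1 : 1 < q := by rw [hq]; exact_mod_cast Fintype.one_lt_card
  have hQ : (Fintype.card E : ℚ) = q ^ 4 := by rw [cast_card_eq hE, hq]
  have hQ1 : q ^ 4 - 1 ≠ 0 := sub_ne_zero.2 (one_lt_pow₀ hq1 (by norm_num)).ne'
  have hQ0 : q ^ 4 ≠ 0 := pow_ne_zero 4 (by positivity)
  have h0 : (whitneyFirst (RankMetricLattice F E 2 4) 0 : ℚ) = 1 := by
    rw [RankMetricLattice.whitneyFirst_zero, Int.cast_one]
  have h1 : (whitneyFirst (RankMetricLattice F E 2 4) 1 : ℚ) =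
      -(q ^ 8 + q ^ 7 + 2 * q ^ 6 - q ^ 3 + 1) := by
    have h := RankMetricLattice.whitneyFirst_one_mul (F := F) (E := E) (i := 2) (n := 4)
    rw [RankMetricLattice.lowRankCount_top, card_vectorRank_mem hE hq, hQ] at h
    refine mul_right_cancel₀ hQ1 ?_
    rw [h]
    ring
  have h2 : (whitneyFirst (RankMetricLattice F E 2 4) 2 : ℚ) =
      1 / 2 * (q ^ 16 + 3 * q ^ 14 + q ^ 13 + 3 * q ^ 12 + q ^ 11 + q ^ 10 - q ^ 9 + q ^ 7
        + 4 * q ^ 6 - 2 * q ^ 3) := by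
    have h := RankMetricLattice.whitneyFirst_two_mul (F := F) (E := E) (n := 4)
    simp only [RankMetricLattice.ne_zero_and_mem_lowRankVectors_two_iff] at h
    rw [hQ, sum_shiftSum hE hq] at h
    exact mul_left_cancel₀ (mul_ne_zero (pow_ne_zero 2 hQ1) hQ0) h
  -- The roots `q ^ 4` and `1` give two linear equations for `w₃` and `w₄`.
  have hχ := RankMetricLattice.sum_mu_mul_pow (F := F) (E := E) (n := 2)
  rw [RankMetricLattice.sum_mu_eq_sum_whitneyFirst (fun j => (Fintype.card E : ℚ) ^ (2 + 2 - j)),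
    hQ] at hχ
  have hχ' := RankMetricLattice.sum_mu_eq_zero (F := F) (E := E) (n := 3)
  rw [RankMetricLattice.sum_mu_eq_sum_whitneyFirst (fun _ => 1)] at hχ'
  simp only [Finset.sum_range_succ, Finset.sum_range_zero, Nat.reduceAdd, Nat.reduceSub,
    zero_add, mul_one, h0, h1, h2] at hχ hχ'
  have h3 : (whitneyFirst (RankMetricLattice F E 2 4) 3 : ℚ) =
      -(1 / 2) * (q ^ 20 + 3 * q ^ 18 + q ^ 17 + 2 * q ^ 16 - q ^ 15 + 3 * q ^ 12 + 2 * q ^ 11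
        + q ^ 10 - q ^ 9 - 2 * q ^ 8 - q ^ 7) := by
    -- Subtracting the equations eliminates `w₄` and leaves `w₃` with coefficient `q ^ 4 - 1`.
    refine mul_left_cancel₀ hQ1 ?_
    linear_combination hχ - hχ'
  have h4 : (whitneyFirst (RankMetricLattice F E 2 4) 4 : ℚ) =
      1 / 2 * (q ^ 20 + 3 * q ^ 18 + q ^ 17 + q ^ 16 - q ^ 15 - 3 * q ^ 14 - q ^ 13 + q ^ 11) := by
    rw [h3] at hχ'
    linear_combination hχ'
  refine ⟨h0, h1, h2, h3, h4, ?_⟩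
  rw [RankMetricLattice.charPolynomial_eq]
  simp only [Finset.sum_range_succ, Finset.sum_range_zero, Nat.reduceAdd, Nat.reduceSub,
    zero_add, h0, h1, h2, h3, h4]
  refine Polynomial.funext fun x => ?_
  simp only [Polynomial.eval_add, Polynomial.eval_sub, Polynomial.eval_mul, Polynomial.eval_pow,
    Polynomial.eval_X, Polynomial.eval_C, Polynomial.eval_one]
  ring
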